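/- **Theorem (Bacon–Casaccino hybrid codes).** Let $\mathbb F_q$ be a finite field of characteristic $p$. For $i=1,2$ let $C_i\subseteq\mathbb F_q^{n_i}$ be an $\mathbb F_q$-linear code with parameters $[n_i,k_i,d_i]_q$ (in particular $C_i\neq 0$), and let $d_i^\perp$ be the minimum distance of the dual code $C_i^\perp$ (with $d_i^\perp=\infty$ if $C_i^\perp=0$). Then there is a hybrid stabilizer code with parameters $$[[\,n_1n_2,\;k_1k_2:(n_1-k_1)(n_2-k_2),\;d:c\,]]_q,\qquad d=\min\{d_1,d_2\},\quad c\ \ge\ \min\{d,\max\{d_1^\perp,d_2^\perp\}\},$$ and it can be obtained by gauge fixing the Bacon–Casaccino subsystem code of $C_1$ and $C_2$. Here the notions are the following. Let $X(\mathbf a)|\mathbf x\rangle=|\mathbf x+\mathbf a\rangle$ and $Z(\mathbf b)|\mathbf x\rangle=e^{2\pi i\,\mathrm{Tr}(\mathbf b\cdot\mathbf x)/p}|\mathbf x\rangle$ be the error operators on $n$ qudits, with $\mathrm{Tr}:\mathbb F_q\to\mathbb F_p$ the trace; the products $X(\mathbf a)Z(\mathbf b)$ generate the error group, and the weight of $X(\mathbf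 a)Z(\mathbf b)$ is the number of $i$ with $(a_i,b_i)\ne(0,0)$. A stabilizer group is an abelian subgroup of the error group whose only scalar element is the identity. *Hybrid code.* An $[[n,k:m,d:c]]_q$ hybrid code has an outer code $\mathcal C\subseteq\mathbb C^{q^n}$ with a subsystem structure $\mathcal C=A\otimes B$, $\dim A=q^k$, $\dim B=q^m$, with orthonormal bases $(\varphi_i)$ of $A$ and $(v_a)$ of $B$; the inner code of the classical message $a$ is $\mathcal C_a=A\otimes v_a$. Put $P_{a,b}=\left(\sum_i|\varphi_i\rangle\langle\varphi_i|\right)\otimes|v_a\rangle\langle v_b|$ and $P_a=P_{a,a}$. The quantum distance $d$ is the least weight of an error $E=X(\mathbf a)Z(\mathbf b)$ for which the condition "for all $a,b$ there is $\lambda_{E,a,b}\in\mathbb C$ with $P_aEP_b=\lambda_{E,a,b}P_{a,b}$" fails; the classical distance $c$ is the least weight of an error $E$ for which the condition "$P_aEP_b=0$ for all $a\neq b$" fails ($\infty$ if there is none). It is a hybrid stabilizer code if $\mathcal C$ is the joint $+1$-eigenspace of a stabilizer group $\mathcal S$ and there is a stabilizer group $\mathcal S_0\supseteq\mathcal S$,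 with joint $+1$-eigenspace $\mathcal C_0$, such that $\mathcal C_a=t_a\mathcal C_0$ for elements $t_a$ of the error group, one of which is the identity, that lie in distinct cosets of the centralizer of $\mathcal S_0$, these cosets forming a group. *Bacon–Casaccino subsystem code.* Index $n_1n_2$ qudits by an $n_1\times n_2$ lattice. The stabilizer group $\mathcal S$ is generated by all $Z(p\otimes v)$ with $p\in C_1^\perp$, $v\in C_2$ and all $X(u\otimes w)$ with $u\in C_1$, $w\in C_2^\perp$; the gauge group $\mathcal G$ is generated by the scalars in the error group, all $Z(p\otimes e_j)$ with $p\in C_1^\perp$ (acting on column $j$) and all $X(e_i\otimes w)$ with $w\in C_2^\perp$ (acting on row $i$). *Gauge fixing.* That the hybrid code is obtained by gauge fixing this subsystem code means: $\mathcal C=A\otimes B$ is the joint $+1$-eigenspace of $\mathcal S$; $\mathcal G$ is exactly the set of elements of the error group that act on $A\otimes B$ as $1\otimes L$ for some operator $L$ on $B$; and $\mathcal S\subseteq\mathcal S_0\subseteq\mathcal G$ and $t_a\in\mathcal G$ for all $a$. -/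

import Mathlib

noncomputable section

/-! Classical linear codes. -/

/-- The minimum Hamming distance between two distinct codewords (`⊤` for the zero code). -/
def minDist {F : Type*} [Field F] [DecidableEq F] {n : ℕ}
    (C : Submodule F (Fin n → F)) : ℕ∞ :=
  ⨅ x ∈ C, ⨅ y ∈ C, ⨅ _ : x ≠ y, (hammingDist x y : ℕ∞)

/-- `C` is an `[n, k, d]_q` linear code, `q = |F|`. As `d` is a natural number, `C ≠ 0`. -/
def IsLinearCode {F : Type*} [Field F] [DecidableEq F] {n : ℕ}
    (C : Submodule F (Fin n → F)) (k d : ℕ) : Prop :=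
  Module.finrank F C = k ∧ minDist C = (d : ℕ∞)

/-- The (Euclidean) dual code. -/
def dualCode {F : Type*} [Field F] {n : ℕ}
    (C : Submodule F (Fin n → F)) : Submodule F (Fin n → F) where
  carrier := {y | ∀ x ∈ C, x ⬝ᵥ y = 0}
  zero_mem' := by intro x _; simp
  add_mem' := by
    intro y z hy hz x hx
    rw [dotProduct_add, hy x hx, hz x hx, add_zero]
  smul_mem' := by
    intro c y hy x hx
    rw [dotProduct_smul, hy x hx, smul_zero]

/-! Qudits, error operators and stabilizer codes. -/

/-- The state space `(ℂ^q)^{⊗ ι}` of qudits labelled by `ι`, with its computational basis labelled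
by `ι → F`. -/
abbrev QuditSpace (F : Type*) [Fintype F] (ι : Type*) [Fintype ι] [DecidableEq ι] : Type _ :=
  EuclideanSpace ℂ (ι → F)

/-- The unitary operators on the state space, as a group under composition. -/
abbrev QuditUnitary (F : Type*) [Fintype F] (ι : Type*) [Fintype ι] [DecidableEq ι] : Type _ :=
  QuditSpace F ι ≃ₗᵢ[ℂ] QuditSpace F ι

/-- `ω ^ Tr t`, where `ω = exp (2πi / p)`, `p` is the characteristic of `F` and `Tr : F → 𝔽_p` is
the trace. -/
def phase {F : Type*} [Field F] (t : F) : ℂ :=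
  letI : Algebra (ZMod (ringChar F)) F := ZMod.algebra F (ringChar F)
  Complex.exp (2 * Real.pi * Complex.I / (ringChar F : ℂ)) ^
    (Algebra.trace (ZMod (ringChar F)) F t).val

lemma norm_phase {F : Type*} [Field F] (t : F) : ‖phase t‖ = 1 := by
  have h : (2 * Real.pi * Complex.I / (ringChar F : ℂ))
      = ((2 * Real.pi / (ringChar F : ℝ) : ℝ) : ℂ) * Complex.I := by
    push_cast
    ring
  unfold phase
  rw [norm_pow, h, Complex.norm_exp_ofReal_mul_I, one_pow]

lemma phase_ne_zero {F : Type*} [Field F] (t : F) : phase t ≠ 0 := by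
  intro h
  have h1 := norm_phase t
  rw [h, norm_zero] at h1
  exact zero_ne_one h1

section Errors

variable {F : Type*} [Field F] [Fintype F] {ι : Type*} [Fintype ι] [DecidableEq ι]

/-- `X(a) |x⟩ = |x + a⟩`. -/
def opX (a : ι → F) : QuditUnitary F ι :=
  LinearIsometryEquiv.piLpCongrLeft 2 ℂ ℂ (Equiv.addRight a)

/-- `Z(b) |x⟩ = ω ^ Tr (b · x) |x⟩`. -/
def opZ (b : ι → F) : QuditUnitary F ι where
  toFun ψ := WithLp.toLp 2 fun x => phase (b ⬝ᵥ x) * ψ x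
  invFun ψ := WithLp.toLp 2 fun x => (phase (b ⬝ᵥ x))⁻¹ * ψ x
  map_add' ψ φ := by ext x; simp [mul_add]
  map_smul' c ψ := by ext x; simp [mul_left_comm]
  left_inv ψ := by ext x; simp [phase_ne_zero]
  right_inv ψ := by ext x; simp [phase_ne_zero]
  norm_map' ψ := by simp [EuclideanSpace.norm_eq, norm_phase]

/-- The weight of `X(a) Z(b)`: the number of tensor components `X(a_i) Z(b_i)` that are not scalar,
i.e. those with `a_i ≠ 0` or `b_i ≠ 0`. -/
def errorWeight [DecidableEq F] (a b : ι → F) : ℕ :=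
  (Finset.univ.filter fun i => a i ≠ 0 ∨ b i ≠ 0).card

variable (F ι) in
/-- The error group `G_n`, generated by the operators `X(a) Z(b)`. -/
def errorGroup : Subgroup (QuditUnitary F ι) :=
  Subgroup.closure {E | ∃ a b : ι → F, E = opX a * opZ b}

/-- `E` is a scalar multiple of the identity. -/
def IsScalarOp (E : QuditUnitary F ι) : Prop := ∃ c : ℂ, ∀ ψ, E ψ = c • ψ

/-- An abelian subgroup of the error group containing no scalar operator except the identity. -/
def IsStabilizerGroup (S : Subgroup (QuditUnitary F ι)) : Prop :=
  S ≤ errorGroup F ι ∧ (∀ E ∈ S, ∀ E' ∈ S, E * E' = E' * E) ∧ ∀ E ∈ S, IsScalarOp E → E = 1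

/-- The joint `+1`-eigenspace of a group of operators. -/
def fixedSpace (S : Subgroup (QuditUnitary F ι)) : Submodule ℂ (QuditSpace F ι) where
  carrier := {ψ | ∀ E ∈ S, E ψ = ψ}
  zero_mem' := by intro E _; simp
  add_mem' := by
    intro ψ φ hψ hφ E hE
    rw [map_add, hψ E hE, hφ E hE]
  smul_mem' := by
    intro c ψ hψ E hE
    rw [map_smul, hψ E hE]

end Errors

/-! Hybrid codes with a subsystem structure. -/

/-- A subsystem structure `A ⊗ B` on a subspace of the state space, given by the orthonormal basis
`state (i, b) = |φ_i⟩ ⊗ |v_b⟩` of that subspace. Quantum information is encoded in the system `A`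
with orthonormal basis `(φ_i)`, classical messages are encoded by the basis vectors `v_b` of `B`. -/
structure HybridCode (F : Type*) [Fintype F] (ι : Type*) [Fintype ι] [DecidableEq ι]
    (A B : Type*) where
  state : A × B → QuditSpace F ι
  orthonormal : Orthonormal ℂ state

namespace HybridCode

variable {F : Type*} [Field F] [Fintype F] {ι : Type*} [Fintype ι] [DecidableEq ι]
  {A B : Type*}

/-- The inner code of the classical message `b`. -/
def inner (Q : HybridCode F ι A B) (b : B) : Submodule ℂ (QuditSpace F ι) :=
  Submodule.span ℂ (Set.range fun i : A => Q.state (i, b))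

/-- The outer code, as the subspace spanned by all inner codes. -/
def outer (Q : HybridCode F ι A B) : Submodule ℂ (QuditSpace F ι) :=
  Submodule.span ℂ (Set.range Q.state)

/-- `P_{a,b} = (∑ i, |φ_i⟩⟨φ_i|) ⊗ |v_a⟩⟨v_b|`. In particular `P_{a,a}` is the orthogonal projector
onto the inner code of the message `a`. -/
def transfer [Fintype A] (Q : HybridCode F ι A B) (a b : B) :
    QuditSpace F ι →L[ℂ] QuditSpace F ι :=
  ∑ i : A, InnerProductSpace.rankOne ℂ (Q.state (i, a)) (Q.state (i, b))

/-- `P_a E P_b`. -/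
def compress [Fintype A] (Q : HybridCode F ι A B) (E : QuditUnitary F ι) (a b : B) :
    QuditSpace F ι →L[ℂ] QuditSpace F ι :=
  (Q.transfer a a).comp
    (((E : QuditSpace F ι ≃L[ℂ] QuditSpace F ι) : QuditSpace F ι →L[ℂ] QuditSpace F ι).comp
      (Q.transfer b b))

/-- The error `E` on the quantum information is detectable: `P_a E P_b = λ_{E,a,b} P_{a,b}`. -/
def DetectsQuantum [Fintype A] (Q : HybridCode F ι A B) (E : QuditUnitary F ι) : Prop :=
  ∀ a b : B, ∃ lam : ℂ, Q.compress E a b = lam • Q.transfer a b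

/-- The error `E` on the classical information is detectable: `P_a E P_b = 0` if `a ≠ b`. -/
def DetectsClassical [Fintype A] (Q : HybridCode F ι A B) (E : QuditUnitary F ι) : Prop :=
  ∀ a b : B, a ≠ b → Q.compress E a b = 0

/-- The minimum distance `d` of the quantum information: the least weight of an error that is not
detectable on the quantum information. -/
def quantumDistance [DecidableEq F] [Fintype A] (Q : HybridCode F ι A B) : ℕ∞ :=
  ⨅ (a : ι → F) (b : ι → F) (_ : ¬ Q.DetectsQuantum (opX a * opZ b)), (errorWeight a b : ℕ∞)

/-- The minimum distance `c` of the classical information: the least weight of an error that is not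
detectable on the classical information. -/
def classicalDistance [DecidableEq F] [Fintype A] (Q : HybridCode F ι A B) : ℕ∞ :=
  ⨅ (a : ι → F) (b : ι → F) (_ : ¬ Q.DetectsClassical (opX a * opZ b)), (errorWeight a b : ℕ∞)

/-- The subsystem structure of `Q` is that of a subsystem code with stabilizer group `S` and gauge
group `G`: the encoding subspace `A ⊗ B` is the joint `+1`-eigenspace of `S`, and `G` consists of
the elements of the error group that act on `A ⊗ B` as `1 ⊗ L` for some operator `L` on `B`. -/
def IsSubsystemCode [Fintype B] (Q : HybridCode F ι A B)
    (S G : Subgroup (QuditUnitary F ι)) : Prop :=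
  IsStabilizerGroup S ∧ Q.outer = fixedSpace S ∧
    ∀ E : QuditUnitary F ι, E ∈ G ↔ E ∈ errorGroup F ι ∧
      ∃ L : Matrix B B ℂ, ∀ (i : A) (b : B), E (Q.state (i, b)) = ∑ b', L b' b • Q.state (i, b')

/-- `Q` is the hybrid stabilizer code whose outer code has stabilizer `S` and whose inner codes are
the translates `t_b C₀` of the stabilizer code `C₀` with stabilizer `S₀`; the translation operators
`t_b` include the identity, lie in different cosets of the centralizer of `S₀`, and these cosets
form a group. -/
def IsHybridStabilizerCode (Q : HybridCode F ι A B) (S S₀ : Subgroup (QuditUnitary F ι))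
    (t : B → QuditUnitary F ι) : Prop :=
  IsStabilizerGroup S ∧ IsStabilizerGroup S₀ ∧ S ≤ S₀ ∧ Q.outer = fixedSpace S ∧
    (∀ b, t b ∈ errorGroup F ι) ∧ (∃ b, t b = 1) ∧
    (∀ b b', b ≠ b' → (t b)⁻¹ * t b' ∉ Subgroup.centralizer (S₀ : Set (QuditUnitary F ι))) ∧
    (∀ b b', ∃ b'', (t b'')⁻¹ * (t b * t b') ∈
      Subgroup.centralizer (S₀ : Set (QuditUnitary F ι))) ∧
    ∀ b, Q.inner b = (fixedSpace S₀).map ((t b).toLinearEquiv : QuditSpace F ι →ₗ[ℂ] QuditSpace F ι)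

/-- `Q` is obtained by gauge fixing from the subsystem code with stabilizer group `S` and gauge
group `G`, keeping its subsystem structure: commuting gauge operators are adjoined to `S` to form
the stabilizer `S₀` of the inner code `C₀`, and the translation operators are gauge operators. -/
def IsGaugeFixing [Fintype B] (Q : HybridCode F ι A B)
    (S G : Subgroup (QuditUnitary F ι)) : Prop :=
  Q.IsSubsystemCode S G ∧ ∃ (S₀ : Subgroup (QuditUnitary F ι)) (t : B → QuditUnitary F ι),
    Q.IsHybridStabilizerCode S S₀ t ∧ S₀ ≤ G ∧ ∀ b, t b ∈ G

end HybridCode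

/-! The Bacon–Casaccino subsystem code of two linear codes: qudits on an `n₁ × n₂` lattice. -/

/-- The pattern `x ⊗ y` on the lattice: the column `j` carries `y_j x`, the row `i` carries
`x_i y`. -/
def latticeTensor {F : Type*} [Field F] {n₁ n₂ : ℕ} (x : Fin n₁ → F) (y : Fin n₂ → F) :
    Fin n₁ × Fin n₂ → F :=
  fun ij => x ij.1 * y ij.2

/-- The stabilizer group, generated by the `Z(p ⊗ v)` with `p ∈ C₁^⊥`, `v ∈ C₂` and the `X(u ⊗ w)`
with `u ∈ C₁`, `w ∈ C₂^⊥`. -/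
def bcStabilizer {F : Type*} [Field F] [Fintype F] {n₁ n₂ : ℕ}
    (C₁ : Submodule F (Fin n₁ → F)) (C₂ : Submodule F (Fin n₂ → F)) :
    Subgroup (QuditUnitary F (Fin n₁ × Fin n₂)) :=
  Subgroup.closure
    ({E | ∃ p ∈ dualCode C₁, ∃ v ∈ C₂, E = opZ (latticeTensor p v)} ∪
      {E | ∃ u ∈ C₁, ∃ w ∈ dualCode C₂, E = opX (latticeTensor u w)})

/-- The gauge group, generated by the scalars in the error group, the `Z`-type checks `p ∈ C₁^⊥`
acting on single columns, and the `X`-type checks `w ∈ C₂^⊥` acting on single rows. -/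
def bcGauge {F : Type*} [Field F] [Fintype F] {n₁ n₂ : ℕ}
    (C₁ : Submodule F (Fin n₁ → F)) (C₂ : Submodule F (Fin n₂ → F)) :
    Subgroup (QuditUnitary F (Fin n₁ × Fin n₂)) :=
  Subgroup.closure
    ({E | E ∈ errorGroup F (Fin n₁ × Fin n₂) ∧ IsScalarOp E} ∪
      {E | ∃ p ∈ dualCode C₁, ∃ j, E = opZ (latticeTensor p (Pi.single j 1))} ∪
      {E | ∃ w ∈ dualCode C₂, ∃ i, E = opX (latticeTensor (Pi.single i 1) w)})

end

open Module
noncomputable section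

/-! Characters of a finite field. -/

section Phase

variable {F : Type*} [Field F]

/-! Let M be the space of lattice patterns with all columns in C₁ and R the space of those with all
rows in C₂^⊥. The Bacon–Casaccino code is of CSS type: up to scalars its gauge group consists of the
X(r)Z(b) with r ∈ R and b ∈ M^⊥, and its stabilizer is generated by X(M ∩ R) and Z(M^⊥ ∩ R^⊥). The
operators X(M) and Z(R^⊥) commute with the gauge group and act on the subsystem A alone.

Any T with M ∩ R ≤ T ≤ R fixes the gauge: adjoin X(T) and Z(M^⊥ ∩ T^⊥). Explicit basis states are
X(α + β)Z(χ)|T⟩, where |T⟩ is the normalized sum over T, α represents M modulo M ∩ R (quantum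
index), β represents R modulo T and χ represents M^⊥ modulo M^⊥ ∩ T^⊥ (together the classical
message). They are orthonormal since error operators with different eigenvalues separate them, and
they span the whole code by a dimension bound (`finrank_fixedSpace_cssGroup_le`).

An error X(a)Z(b) undetected on the quantum side commutes with the stabilizer, so a ∈ M + R and b ∈
M^⊥ + R^⊥, but is not a gauge operator, so a ∉ R or b ∉ M^⊥. Contracting the rows of a with a word
of C₂, or the columns of b with a word of C₁, then gives a nonzero word of C₁ or C₂ of no larger
weight (`minDist_le_of_notMem_rowSpace`, `minDist_le_of_notMem_colSpace`). Hence d ≥ min(d₁, d₂),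
and single-column and single-row words attain it.

An error undetected on the classical side moreover fails a ∈ M + T or b ∈ T^⊥. For T = M ∩ R this
means a ∉ M, and the same contraction gives weight at least d₂^⊥; for T = R it means b ∉ R^⊥, and
the weight is at least d₁^⊥. Taking the better of the two choices gives c ≥ max(d₁^⊥, d₂^⊥). -/

lemma phase_add [Fintype F] (s t : F) : phase (s + t) = phase s * phase t := by
  have hp : (ringChar F).Prime := CharP.char_is_prime F _
  have : NeZero (ringChar F) := ⟨hp.ne_zero⟩
  unfold phase
  simp only [map_add]
  rw [← pow_add, ZMod.val_add]
  exact (pow_eq_pow_mod _ (Complex.isPrimitiveRoot_exp _ hp.ne_zero).pow_eq_one).symm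

@[simp] lemma phase_zero : phase (0 : F) = 1 := by simp [phase]

lemma phase_neg [Fintype F] (t : F) : phase (-t) = (phase t)⁻¹ :=
  eq_inv_of_mul_eq_one_left (by rw [← phase_add, neg_add_cancel, phase_zero])

lemma phase_mul_conj (t : F) : starRingEnd ℂ (phase t) * phase t = 1 := by
  rw [mul_comm, Complex.mul_conj, Complex.normSq_eq_norm_sq, norm_phase]; simp

/-- The trace form is nondegenerate and ω is a primitive p-th root of unity, so a nonzero trace is
visible in the phase. -/
lemma exists_phase_mul_ne_one [Fintype F] {a : F} (ha : a ≠ 0) : ∃ b : F, phase (b * a) ≠ 1 := by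
  have hp : (ringChar F).Prime := CharP.char_is_prime F _
  have : NeZero (ringChar F) := ⟨hp.ne_zero⟩
  let : Algebra (ZMod (ringChar F)) F := ZMod.algebra F (ringChar F)
  obtain ⟨b, hb⟩ := FiniteField.trace_to_zmod_nondegenerate F ha
  refine ⟨b, fun h => hb ?_⟩
  have h' := ((Complex.isPrimitiveRoot_exp _ hp.ne_zero).pow_eq_one_iff_dvd _).1 h
  have := Nat.eq_zero_of_dvd_of_lt h' (ZMod.val_lt _)
  rw [mul_comm]
  exact (ZMod.val_eq_zero _).1 this

end Phase

/-! Orthogonal complements for the dot product. -/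

section Perp

variable {F : Type*} [Field F] {ι : Type*} [Fintype ι]

/-- The orthogonal complement for the dot product. -/
def perp (K : Submodule F (ι → F)) : Submodule F (ι → F) :=
  LinearMap.BilinForm.orthogonal (dotProductBilin F F) K

variable {K L : Submodule F (ι → F)}

lemma mem_perp {y : ι → F} : y ∈ perp K ↔ ∀ x ∈ K, x ⬝ᵥ y = 0 := Iff.rfl

lemma mem_perp' {y : ι → F} : y ∈ perp K ↔ ∀ x ∈ K, y ⬝ᵥ x = 0 := by
  simp only [mem_perp, dotProduct_comm]

lemma dotProductBilin_isRefl :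
    LinearMap.BilinForm.IsRefl (dotProductBilin F F : LinearMap.BilinForm F (ι → F)) :=
  fun x y h => (dotProduct_comm y x).trans h

lemma dotProductBilin_nondegenerate :
    (dotProductBilin F F : LinearMap.BilinForm F (ι → F)).Nondegenerate := by
  classical
  exact ⟨fun x h => dotProduct_eq_zero x h,
    fun x h => dotProduct_eq_zero x fun w => (dotProduct_comm x w).trans (h w)⟩

@[simp] lemma perp_perp (K : Submodule F (ι → F)) : perp (perp K) = K :=
  LinearMap.BilinForm.orthogonal_orthogonal dotProductBilin_nondegenerate dotProductBilin_isRefl K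

lemma finrank_perp (K : Submodule F (ι → F)) :
    finrank F (perp K) = Fintype.card ι - finrank F K := by
  rw [perp, LinearMap.BilinForm.finrank_orthogonal dotProductBilin_nondegenerate,
    Module.finrank_fintype_fun_eq_card]

lemma perp_anti (h : K ≤ L) : perp L ≤ perp K := fun _ hy x hx => hy x (h hx)

lemma perp_sup (K L : Submodule F (ι → F)) : perp (K ⊔ L) = perp K ⊓ perp L := by
  refine le_antisymm (le_inf (perp_anti le_sup_left) (perp_anti le_sup_right)) ?_
  rintro y ⟨hK, hL⟩ x hx
  obtain ⟨u, hu, v, hv, rfl⟩ := Submodule.mem_sup.1 hx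
  change (u + v) ⬝ᵥ y = 0
  rw [add_dotProduct, mem_perp.1 hK u hu, mem_perp.1 hL v hv, add_zero]

lemma perp_inf (K L : Submodule F (ι → F)) : perp (K ⊓ L) = perp K ⊔ perp L := by
  rw [← perp_perp (perp K ⊔ perp L), perp_sup, perp_perp, perp_perp]

lemma perp_inf_perp (K L : Submodule F (ι → F)) : perp (perp K ⊓ perp L) = K ⊔ L := by
  rw [perp_inf, perp_perp, perp_perp]

/-- A nonzero dot product may have trace zero; since K is closed under scalars, rescaling x repairs
this. Every failure of membership is thereby turned into an explicit operator with a nontrivial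
commutation phase. -/
lemma exists_phase_dotProduct_ne_one [Fintype F] {y : ι → F} (h : y ∉ perp K) :
    ∃ x ∈ K, phase (x ⬝ᵥ y) ≠ 1 := by
  rw [mem_perp] at h
  push Not at h
  obtain ⟨x, hx, hxy⟩ := h
  obtain ⟨b, hb⟩ := exists_phase_mul_ne_one hxy
  exact ⟨b • x, K.smul_mem b hx, by rwa [smul_dotProduct, smul_eq_mul]⟩

lemma exists_phase_dotProduct_ne_one' [Fintype F] {y : ι → F} (h : y ∉ K) :
    ∃ x ∈ perp K, phase (x ⬝ᵥ y) ≠ 1 :=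
  exists_phase_dotProduct_ne_one (by rwa [perp_perp])

lemma dualCode_eq_perp {n : ℕ} (C : Submodule F (Fin n → F)) : dualCode C = perp C := rfl

end Perp

/-! Subspaces of patterns on a lattice. -/

section Lattice

variable {F : Type*} [Field F] {n₁ n₂ : ℕ}

/-- The patterns on the lattice all of whose columns lie in `C`. -/
def colSpace (n₂ : ℕ) (C : Submodule F (Fin n₁ → F)) : Submodule F (Fin n₁ × Fin n₂ → F) where
  carrier := {a | ∀ j, (fun i => a (i, j)) ∈ C}
  zero_mem' _ := C.zero_mem
  add_mem' ha hb j := C.add_mem (ha j) (hb j)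
  smul_mem' c _ ha j := C.smul_mem c (ha j)

/-- The patterns on the lattice all of whose rows lie in `D`. -/
def rowSpace (n₁ : ℕ) (D : Submodule F (Fin n₂ → F)) : Submodule F (Fin n₁ × Fin n₂ → F) where
  carrier := {a | ∀ i, (fun j => a (i, j)) ∈ D}
  zero_mem' _ := D.zero_mem
  add_mem' ha hb i := D.add_mem (ha i) (hb i)
  smul_mem' c _ ha i := D.smul_mem c (ha i)

lemma mem_colSpace {C : Submodule F (Fin n₁ → F)} {a : Fin n₁ × Fin n₂ → F} :
    a ∈ colSpace n₂ C ↔ ∀ j, (fun i => a (i, j)) ∈ C := Iff.rfl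

lemma mem_rowSpace {D : Submodule F (Fin n₂ → F)} {a : Fin n₁ × Fin n₂ → F} :
    a ∈ rowSpace n₁ D ↔ ∀ i, (fun j => a (i, j)) ∈ D := Iff.rfl

lemma latticeTensor_dotProduct (x : Fin n₁ → F) (y : Fin n₂ → F) (a : Fin n₁ × Fin n₂ → F) :
    latticeTensor x y ⬝ᵥ a = ∑ i, ∑ j, x i * y j * a (i, j) := by
  simp [dotProduct, latticeTensor, Fintype.sum_prod_type]

lemma latticeTensor_dotProduct_left (x : Fin n₁ → F) (y : Fin n₂ → F)
    (a : Fin n₁ × Fin n₂ → F) :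
    latticeTensor x y ⬝ᵥ a = x ⬝ᵥ fun i => (fun j => a (i, j)) ⬝ᵥ y := by
  rw [latticeTensor_dotProduct]
  simp only [dotProduct, Finset.mul_sum]
  exact Finset.sum_congr rfl fun i _ => Finset.sum_congr rfl fun j _ => by ring

lemma latticeTensor_dotProduct_right (x : Fin n₁ → F) (y : Fin n₂ → F)
    (a : Fin n₁ × Fin n₂ → F) :
    latticeTensor x y ⬝ᵥ a = y ⬝ᵥ fun j => (fun i => a (i, j)) ⬝ᵥ x := by
  rw [latticeTensor_dotProduct, Finset.sum_comm]
  simp only [dotProduct, Finset.mul_sum]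
  exact Finset.sum_congr rfl fun i _ => Finset.sum_congr rfl fun j _ => by ring

lemma latticeTensor_single_right_dotProduct (x : Fin n₁ → F) (j : Fin n₂)
    (a : Fin n₁ × Fin n₂ → F) :
    latticeTensor x (Pi.single j 1) ⬝ᵥ a = x ⬝ᵥ fun i => a (i, j) := by
  simp [latticeTensor_dotProduct_left]

lemma latticeTensor_single_left_dotProduct (i : Fin n₁) (y : Fin n₂ → F)
    (a : Fin n₁ × Fin n₂ → F) :
    latticeTensor (Pi.single i 1) y ⬝ᵥ a = y ⬝ᵥ fun j => a (i, j) := by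
  simp [latticeTensor_dotProduct_right]

lemma latticeTensor_mem_colSpace {C : Submodule F (Fin n₁ → F)} {x : Fin n₁ → F} (hx : x ∈ C)
    (y : Fin n₂ → F) : latticeTensor x y ∈ colSpace n₂ C := fun j => by
  convert! C.smul_mem (y j) hx using 1
  ext i
  simp [latticeTensor, mul_comm]

lemma latticeTensor_mem_rowSpace {D : Submodule F (Fin n₂ → F)} {y : Fin n₂ → F} (hy : y ∈ D)
    (x : Fin n₁ → F) : latticeTensor x y ∈ rowSpace n₁ D := fun i => by
  convert! D.smul_mem (x i) hy using 1

lemma perp_colSpace (C : Submodule F (Fin n₁ → F)) :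
    perp (colSpace n₂ C) = colSpace n₂ (perp C) := by
  ext a
  constructor
  · intro h j x hx
    have := mem_perp.1 h _ (latticeTensor_mem_colSpace hx (Pi.single j 1))
    rwa [latticeTensor_single_right_dotProduct] at this
  · intro h x hx
    change x ⬝ᵥ a = 0
    rw [dotProduct, Fintype.sum_prod_type, Finset.sum_comm]
    exact Finset.sum_eq_zero fun j _ => mem_perp.1 (h j) _ (hx j)

lemma perp_rowSpace (D : Submodule F (Fin n₂ → F)) :
    perp (rowSpace n₁ D) = rowSpace n₁ (perp D) := by
  ext a
  constructor
  · intro h i y hy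
    have := mem_perp.1 h _ (latticeTensor_mem_rowSpace hy (Pi.single i 1))
    rwa [latticeTensor_single_left_dotProduct] at this
  · intro h x hx
    change x ⬝ᵥ a = 0
    rw [dotProduct, Fintype.sum_prod_type]
    exact Finset.sum_eq_zero fun i _ => mem_perp.1 (h i) _ (hx i)

/-- The tensor product of two codes consists of the patterns with columns in the first code and
rows in the second one. -/
lemma span_latticeTensor (C : Submodule F (Fin n₁ → F)) (D : Submodule F (Fin n₂ → F)) :
    Submodule.span F {a | ∃ u ∈ C, ∃ w ∈ D, a = latticeTensor u w}
      = colSpace n₂ C ⊓ rowSpace n₁ D := by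
  apply le_antisymm
  · rw [Submodule.span_le]
    rintro _ ⟨u, hu, w, hw, rfl⟩
    exact ⟨latticeTensor_mem_colSpace hu w, latticeTensor_mem_rowSpace hw u⟩
  · rintro a ⟨hc, hr⟩
    obtain ⟨C', hC'⟩ := Submodule.exists_isCompl C
    -- A projection f onto C fixes every column of a. Expanding the columns in unit vectors writes a
    -- as the sum of f(e_i) ⊗ (row i of a), whose factors lie in C and D.
    set f : (Fin n₁ → F) →ₗ[F] (Fin n₁ → F) := C.subtype ∘ₗ C.projectionOnto C' hC' with hf
    have ha : a = ∑ i, latticeTensor (f (Pi.single i 1)) (fun j => a (i, j)) := by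
      ext ⟨i', j⟩
      have h1 : f (fun i => a (i, j)) = fun i => a (i, j) := by
        have := Submodule.projectionOnto_apply_left hC' ⟨_, hc j⟩
        rw [hf, LinearMap.comp_apply]
        exact congrArg Subtype.val this
      have h2 : (fun i => a (i, j)) = ∑ i, a (i, j) • (Pi.single i 1 : Fin n₁ → F) :=
        pi_eq_sum_univ' _
      rw [h2, map_sum] at h1
      have h3 := congrFun h1 i'
      rw [← h2] at h3
      simp only [map_smul, Finset.sum_apply, Pi.smul_apply, smul_eq_mul] at h3
      rw [Finset.sum_apply, ← h3]
      exact Finset.sum_congr rfl fun i _ => mul_comm _ _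
    rw [ha]
    refine Submodule.sum_mem _ fun i _ => Submodule.subset_span ⟨_, ?_, _, hr i, rfl⟩
    exact (C.projectionOnto C' hC' _).2

/-- Over a field C ⊗ D embeds into the tensor product of the ambient spaces, and its image in
coordinates is the span of the patterns u ⊗ w. -/
lemma finrank_colSpace_inf_rowSpace (C : Submodule F (Fin n₁ → F))
    (D : Submodule F (Fin n₂ → F)) :
    finrank F (colSpace n₂ C ⊓ rowSpace n₁ D : Submodule F (Fin n₁ × Fin n₂ → F))
      = finrank F C * finrank F D := by
  open TensorProduct in
  let b := (Pi.basisFun F (Fin n₁)).tensorProduct (Pi.basisFun F (Fin n₂))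
  have hb : ∀ x y, b.equivFun (x ⊗ₜ[F] y) = latticeTensor x y := by
    intro x y
    ext ⟨i, j⟩
    simp [b, latticeTensor, mul_comm]
  let f := b.equivFun.toLinearMap ∘ₗ TensorProduct.map C.subtype D.subtype
  have hf : Function.Injective f := b.equivFun.injective.comp
    (TensorProduct.map_injective_of_flat_flat _ _ C.injective_subtype D.injective_subtype)
  rw [← Module.finrank_tensorProduct, ← LinearMap.finrank_range_of_inj hf, ← span_latticeTensor,
    LinearMap.range_comp, TensorProduct.range_map_eq_span_tmul, Submodule.map_span]
  suffices h : {a | ∃ u ∈ C, ∃ w ∈ D, a = latticeTensor u w} = b.equivFun.toLinearMap ''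
      {t | ∃ m n, C.subtype m ⊗ₜ[F] D.subtype n = t} by rw [h]
  ext a
  constructor
  · rintro ⟨u, hu, w, hw, rfl⟩
    exact ⟨u ⊗ₜ w, ⟨⟨u, hu⟩, ⟨w, hw⟩, rfl⟩, hb u w⟩
  · rintro ⟨_, ⟨⟨u, hu⟩, ⟨w, hw⟩, rfl⟩, rfl⟩
    exact ⟨u, hu, w, hw, hb u w⟩

lemma colSpace_top : colSpace n₂ (⊤ : Submodule F (Fin n₁ → F)) = ⊤ :=
  eq_top_iff.2 fun _ _ _ => Submodule.mem_top

lemma rowSpace_top : rowSpace n₁ (⊤ : Submodule F (Fin n₂ → F)) = ⊤ :=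
  eq_top_iff.2 fun _ _ _ => Submodule.mem_top

lemma finrank_colSpace (C : Submodule F (Fin n₁ → F)) :
    finrank F (colSpace n₂ C) = finrank F C * n₂ := by
  have h := finrank_colSpace_inf_rowSpace C (⊤ : Submodule F (Fin n₂ → F))
  rwa [rowSpace_top, inf_top_eq, finrank_top, finrank_fin_fun] at h

lemma finrank_rowSpace (D : Submodule F (Fin n₂ → F)) :
    finrank F (rowSpace n₁ D) = n₁ * finrank F D := by
  have h := finrank_colSpace_inf_rowSpace (⊤ : Submodule F (Fin n₁ → F)) D
  rwa [colSpace_top, top_inf_eq, finrank_top, finrank_fin_fun] at h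

end Lattice

/-! The error group. -/

section Operators

variable {F : Type*} [Field F] [Fintype F] {ι : Type*} [Fintype ι] [DecidableEq ι]

lemma opX_apply (a : ι → F) (ψ : QuditSpace F ι) (x : ι → F) : opX a ψ x = ψ (x - a) := by
  simp [opX, sub_eq_add_neg]

lemma opZ_apply (b : ι → F) (ψ : QuditSpace F ι) (x : ι → F) :
    opZ b ψ x = phase (b ⬝ᵥ x) * ψ x := rfl

lemma opX_opX (a a' : ι → F) (ψ : QuditSpace F ι) : opX a (opX a' ψ) = opX (a + a') ψ := by
  ext x
  simp only [opX_apply]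
  rw [sub_sub]

lemma opZ_opZ (b b' : ι → F) (ψ : QuditSpace F ι) : opZ b (opZ b' ψ) = opZ (b + b') ψ := by
  ext x
  simp only [opZ_apply]
  rw [add_dotProduct, phase_add, mul_assoc]

lemma opZ_opX (a b : ι → F) (ψ : QuditSpace F ι) :
    opZ b (opX a ψ) = phase (b ⬝ᵥ a) • opX a (opZ b ψ) := by
  ext x
  simp only [opZ_apply, opX_apply, PiLp.smul_apply, smul_eq_mul]
  rw [← mul_assoc, ← phase_add, ← dotProduct_add, add_sub_cancel]

lemma opX_opZ (a b : ι → F) (ψ : QuditSpace F ι) :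
    opX a (opZ b ψ) = phase (-(b ⬝ᵥ a)) • opZ b (opX a ψ) := by
  rw [opZ_opX, smul_smul, ← phase_add, neg_add_cancel, phase_zero, one_smul]

lemma opX_add (a a' : ι → F) : opX (a + a') = opX a * opX a' :=
  LinearIsometryEquiv.ext fun ψ => (opX_opX a a' ψ).symm

lemma opZ_add (b b' : ι → F) : opZ (b + b') = opZ b * opZ b' :=
  LinearIsometryEquiv.ext fun ψ => (opZ_opZ b b' ψ).symm

@[simp] lemma opX_zero : opX (0 : ι → F) = 1 :=
  LinearIsometryEquiv.ext fun ψ => by ext x; simp [opX_apply]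

@[simp] lemma opZ_zero : opZ (0 : ι → F) = 1 :=
  LinearIsometryEquiv.ext fun ψ => by ext x; simp [opZ_apply]

lemma opX_mem_of_sum {κ : Type*} {H : Subgroup (QuditUnitary F ι)} (s : Finset κ)
    {f : κ → ι → F} (h : ∀ k ∈ s, opX (f k) ∈ H) : opX (∑ k ∈ s, f k) ∈ H :=
  Finset.sum_induction f (fun a => opX a ∈ H)
    (fun a a' ha ha' => by rw [opX_add]; exact H.mul_mem ha ha') (by simp) h

lemma opZ_mem_of_sum {κ : Type*} {H : Subgroup (QuditUnitary F ι)} (s : Finset κ)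
    {f : κ → ι → F} (h : ∀ k ∈ s, opZ (f k) ∈ H) : opZ (∑ k ∈ s, f k) ∈ H :=
  Finset.sum_induction f (fun a => opZ a ∈ H)
    (fun a a' ha ha' => by rw [opZ_add]; exact H.mul_mem ha ha') (by simp) h

lemma opX_mul_opZ_mem_errorGroup (a b : ι → F) : opX a * opZ b ∈ errorGroup F ι :=
  Subgroup.subset_closure ⟨a, b, rfl⟩

lemma opX_mem_errorGroup (a : ι → F) : opX a ∈ errorGroup F ι := by
  simpa using opX_mul_opZ_mem_errorGroup a 0

lemma opZ_mem_errorGroup (b : ι → F) : opZ b ∈ errorGroup F ι := by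
  simpa using opX_mul_opZ_mem_errorGroup 0 b

lemma weyl_mul (t t' : F) (a a' b b' : ι → F) (ψ : QuditSpace F ι) :
    phase t • opX a (opZ b (phase t' • opX a' (opZ b' ψ)))
      = phase (t + t' + b ⬝ᵥ a') • opX (a + a') (opZ (b + b') ψ) := by
  rw [map_smul, map_smul, opZ_opX, map_smul, opX_opX, opZ_opZ, smul_smul, smul_smul,
    phase_add, phase_add, mul_assoc]

/-- The scalar multiples `ω ^ Tr t • X(a) Z(b)` with `a ∈ P` and `b ∈ K`. -/
def weylSubgroup (P K : Submodule F (ι → F)) : Subgroup (QuditUnitary F ι) where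
  carrier := {E | ∃ t : F, ∃ a ∈ P, ∃ b ∈ K, ∀ ψ, E ψ = phase t • opX a (opZ b ψ)}
  one_mem' := ⟨0, 0, P.zero_mem, 0, K.zero_mem, fun ψ => by simp⟩
  mul_mem' := by
    rintro E E' ⟨t, a, ha, b, hb, h⟩ ⟨t', a', ha', b', hb', h'⟩
    refine ⟨t + t' + b ⬝ᵥ a', a + a', P.add_mem ha ha', b + b', K.add_mem hb hb', fun ψ => ?_⟩
    rw [← weyl_mul, ← h', ← h]
    rfl
  inv_mem' := by
    rintro E ⟨t, a, ha, b, hb, h⟩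
    -- The exponent t' of the inverse solves t + t' + b · (-a) = 0, the phase rule of `weyl_mul`.
    refine ⟨b ⬝ᵥ a - t, -a, P.neg_mem ha, -b, K.neg_mem hb, fun ψ => E.injective ?_⟩
    rw [h (phase _ • _), weyl_mul]
    simp

lemma errorGroup_le_weylSubgroup : errorGroup F ι ≤ weylSubgroup ⊤ ⊤ := by
  rw [errorGroup, Subgroup.closure_le]
  rintro _ ⟨a, b, rfl⟩
  exact ⟨0, a, trivial, b, trivial, fun ψ => by simp⟩

lemma isScalarOp_of_weyl {E : QuditUnitary F ι} {t : F} {a b : ι → F}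
    (h : ∀ ψ, E ψ = phase t • opX a (opZ b ψ)) (hE : IsScalarOp E) :
    a = 0 ∧ ∀ ψ, E ψ = phase t • ψ := by
  obtain ⟨c, hc⟩ := hE
  have hc' : ∀ (ψ : QuditSpace F ι) x,
      c * ψ x = phase t * (phase (b ⬝ᵥ (x - a)) * ψ (x - a)) := fun ψ x => by
    have := congrArg (fun φ : QuditSpace F ι => φ x) ((hc ψ).symm.trans (h ψ))
    simpa [opX_apply, opZ_apply] using this
  -- At x = a the phase of Z(b) is trivial; testing on the basis vector at 0 then forces first a = 0
  -- and afterwards c = phase t.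
  have h0 : ∀ ψ : QuditSpace F ι, c * ψ a = phase t * ψ 0 := fun ψ => by
    simpa using hc' ψ a
  classical
  have ha : a = 0 := by
    by_contra ha
    have := h0 (EuclideanSpace.single 0 1)
    simp only [PiLp.single_apply, ha, if_false, if_true, mul_zero, mul_one] at this
    exact phase_ne_zero t this.symm
  have hct : c = phase t := by
    have := h0 (EuclideanSpace.single 0 1)
    simpa [ha] using this
  exact ⟨ha, fun ψ => hct ▸ hc ψ⟩

/-- The group generated by the `X(a)` with `a ∈ P` and the `Z(b)` with `b ∈ K`. -/
def cssGroup (P K : Submodule F (ι → F)) : Subgroup (QuditUnitary F ι) :=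
  Subgroup.closure ({E | ∃ a ∈ P, E = opX a} ∪ {E | ∃ b ∈ K, E = opZ b})

variable {P K P' K' : Submodule F (ι → F)}

lemma opX_mem_cssGroup {a : ι → F} (ha : a ∈ P) : opX a ∈ cssGroup P K :=
  Subgroup.subset_closure (Or.inl ⟨a, ha, rfl⟩)

lemma opZ_mem_cssGroup {b : ι → F} (hb : b ∈ K) : opZ b ∈ cssGroup P K :=
  Subgroup.subset_closure (Or.inr ⟨b, hb, rfl⟩)

lemma cssGroup_le {H : Subgroup (QuditUnitary F ι)} :
    cssGroup P K ≤ H ↔ (∀ a ∈ P, opX a ∈ H) ∧ ∀ b ∈ K, opZ b ∈ H := by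
  refine ⟨fun h => ⟨fun a ha => h (opX_mem_cssGroup ha), fun b hb => h (opZ_mem_cssGroup hb)⟩,
    fun ⟨h1, h2⟩ => ?_⟩
  rw [cssGroup, Subgroup.closure_le]
  rintro _ (⟨a, ha, rfl⟩ | ⟨b, hb, rfl⟩)
  exacts [h1 a ha, h2 b hb]

lemma cssGroup_mono (hP : P ≤ P') (hK : K ≤ K') : cssGroup P K ≤ cssGroup P' K' :=
  cssGroup_le.2 ⟨fun _ ha => opX_mem_cssGroup (hP ha), fun _ hb => opZ_mem_cssGroup (hK hb)⟩

lemma cssGroup_le_weylSubgroup : cssGroup P K ≤ weylSubgroup P K :=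
  cssGroup_le.2 ⟨fun a ha => ⟨0, a, ha, 0, K.zero_mem, fun ψ => by simp⟩,
    fun b hb => ⟨0, 0, P.zero_mem, b, hb, fun ψ => by simp⟩⟩

lemma cssGroup_le_errorGroup : cssGroup P K ≤ errorGroup F ι :=
  cssGroup_le.2 ⟨fun a _ => opX_mem_errorGroup a, fun b _ => opZ_mem_errorGroup b⟩

/-- Orthogonality of P and K makes the generators commute, so reordering a word produces no phase.
This is why the group contains no scalar but the identity. -/
lemma eq_opX_mul_opZ_of_mem_cssGroup (h : K ≤ perp P) {E : QuditUnitary F ι}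
    (hE : E ∈ cssGroup P K) : ∃ a ∈ P, ∃ b ∈ K, E = opX a * opZ b := by
  have hcomm : ∀ a ∈ P, ∀ b ∈ K, opZ b * opX a = opX a * opZ b := fun a ha b hb =>
    LinearIsometryEquiv.ext fun ψ => by
      have := opZ_opX a b ψ
      rwa [mem_perp'.1 (h hb) a ha, phase_zero, one_smul] at this
  have hmul : ∀ a ∈ P, ∀ b ∈ K, ∀ a' ∈ P, ∀ b' ∈ K,
      opX a * opZ b * (opX a' * opZ b') = opX (a + a') * opZ (b + b') := by
    intro a _ b hb a' ha' b' _
    rw [opX_add, opZ_add, mul_assoc, ← mul_assoc (opZ b), hcomm a' ha' b hb]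
    simp only [mul_assoc]
  refine Subgroup.closure_induction ?_ ?_ ?_ ?_ hE
  · rintro _ (⟨a, ha, rfl⟩ | ⟨b, hb, rfl⟩)
    · exact ⟨a, ha, 0, K.zero_mem, by simp⟩
    · exact ⟨0, P.zero_mem, b, hb, by simp⟩
  · exact ⟨0, P.zero_mem, 0, K.zero_mem, by simp⟩
  · rintro _ _ _ _ ⟨a, ha, b, hb, rfl⟩ ⟨a', ha', b', hb', rfl⟩
    exact ⟨_, P.add_mem ha ha', _, K.add_mem hb hb', hmul a ha b hb a' ha' b' hb'⟩
  · rintro _ _ ⟨a, ha, b, hb, rfl⟩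
    refine ⟨-a, P.neg_mem ha, -b, K.neg_mem hb, inv_eq_of_mul_eq_one_right ?_⟩
    rw [hmul a ha b hb _ (P.neg_mem ha) _ (K.neg_mem hb)]
    simp

lemma isStabilizerGroup_cssGroup (h : K ≤ perp P) : IsStabilizerGroup (cssGroup P K) := by
  refine ⟨cssGroup_le_errorGroup, fun E hE E' hE' => ?_, fun E hE hs => ?_⟩
  · obtain ⟨a, ha, b, hb, rfl⟩ := eq_opX_mul_opZ_of_mem_cssGroup h hE
    obtain ⟨a', ha', b', hb', rfl⟩ := eq_opX_mul_opZ_of_mem_cssGroup h hE'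
    ext1 ψ
    change opX a (opZ b (opX a' (opZ b' ψ))) = opX a' (opZ b' (opX a (opZ b ψ)))
    rw [opZ_opX, opZ_opX a b', mem_perp'.1 (h hb) a' ha', mem_perp'.1 (h hb') a ha, phase_zero,
      one_smul, one_smul, opX_opX, opX_opX, opZ_opZ, opZ_opZ, add_comm a, add_comm b]
  · obtain ⟨a, ha, b, hb, rfl⟩ := eq_opX_mul_opZ_of_mem_cssGroup h hE
    obtain ⟨-, h2⟩ := isScalarOp_of_weyl (t := 0) (a := a) (b := b) (fun ψ => by simp) hs
    ext1 ψ
    simpa using h2 ψ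

/-- The operators fixing a given ψ form a subgroup, so only generators need checking. -/
lemma mem_fixedSpace_cssGroup {ψ : QuditSpace F ι} :
    ψ ∈ fixedSpace (cssGroup P K) ↔ (∀ a ∈ P, opX a ψ = ψ) ∧ ∀ b ∈ K, opZ b ψ = ψ :=
  cssGroup_le (H :=
    { carrier := {E | E ψ = ψ}
      one_mem' := rfl
      mul_mem' := fun {E E'} (h : E ψ = ψ) (h' : E' ψ = ψ) => (congrArg E h').trans h
      inv_mem' := fun {E} h => (E.symm_apply_eq).2 (Eq.symm h) })

/-- A bound on the dimension of a CSS code. -/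
lemma finrank_fixedSpace_cssGroup_le {U : Submodule F (ι → F)} (hU : perp K ≤ U ⊔ P) :
    finrank ℂ (fixedSpace (cssGroup P K)) ≤ Fintype.card F ^ finrank F U := by
  let f : fixedSpace (cssGroup P K) →ₗ[ℂ] (U → ℂ) :=
    { toFun := fun ψ u => ψ.1 u
      map_add' := fun _ _ => rfl
      map_smul' := fun _ _ => rfl }
  have hf : Function.Injective f := by
    rw [← LinearMap.ker_eq_bot, LinearMap.ker_eq_bot']
    rintro ⟨ψ, hψ⟩ h
    obtain ⟨hX, hZ⟩ := mem_fixedSpace_cssGroup.1 hψ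
    ext x
    change ψ x = 0
    -- Invariance under Z(K) makes ψ vanish off K^⊥, and invariance under X(P) makes it constant on
    -- cosets of P. Its values on U therefore determine it.
    by_cases hx : x ∈ perp K
    · obtain ⟨u, hu, a, ha, rfl⟩ := Submodule.mem_sup.1 (hU hx)
      rw [← hX a ha, opX_apply, add_sub_cancel_right]
      exact congrFun h ⟨u, hu⟩
    · obtain ⟨b, hb, hbx⟩ := exists_phase_dotProduct_ne_one hx
      have h1 := congrArg (fun φ : QuditSpace F ι => φ x) (hZ b hb)
      simp only [opZ_apply] at h1
      by_contra h0
      exact hbx (mul_right_cancel₀ h0 (h1.trans (one_mul _).symm))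
  have := LinearMap.finrank_le_finrank_of_injective hf
  classical
  rwa [Module.finrank_fintype_fun_eq_card, Module.card_eq_pow_finrank (K := F) (V := U)] at this

end Operators

/-! The groups of the Bacon–Casaccino code. -/

section BaconCasaccino

lemma smul_latticeTensor {F : Type*} [Field F] {n₁ n₂ : ℕ}
    (c : F) (x : Fin n₁ → F) (y : Fin n₂ → F) :
    c • latticeTensor x y = latticeTensor (c • x) y := by
  ext ij
  simp [latticeTensor, mul_assoc]

variable {F : Type*} [Field F] [Fintype F] {n₁ n₂ : ℕ}
  (C₁ : Submodule F (Fin n₁ → F)) (C₂ : Submodule F (Fin n₂ → F))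

lemma bcStabilizer_eq : bcStabilizer C₁ C₂ =
    cssGroup (colSpace n₂ C₁ ⊓ rowSpace n₁ (perp C₂))
      (colSpace n₂ (perp C₁) ⊓ rowSpace n₁ C₂) := by
  apply le_antisymm
  · rw [bcStabilizer, Subgroup.closure_le]
    rintro _ (⟨p, hp, v, hv, rfl⟩ | ⟨u, hu, w, hw, rfl⟩)
    · exact opZ_mem_cssGroup ⟨latticeTensor_mem_colSpace hp v, latticeTensor_mem_rowSpace hv p⟩
    · exact opX_mem_cssGroup ⟨latticeTensor_mem_colSpace hu w, latticeTensor_mem_rowSpace hw u⟩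
  · rw [cssGroup_le, ← span_latticeTensor, ← span_latticeTensor]
    constructor
    · intro a ha
      rw [← one_smul F a]
      -- A generated subgroup is only closed under addition of patterns, whereas the span allows
      -- scalars. The induction carries all multiples c at once, and c is absorbed into the factor u
      -- ∈ C₁.
      refine Submodule.span_induction (p := fun a _ => ∀ c : F, opX (c • a) ∈ bcStabilizer C₁ C₂)
        ?_ ?_ ?_ ?_ ha 1
      · rintro _ ⟨u, hu, w, hw, rfl⟩ c
        exact Subgroup.subset_closure
          (Or.inr ⟨c • u, C₁.smul_mem c hu, w, hw, by rw [smul_latticeTensor]⟩)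
      · intro c
        simp
      · intro a a' _ _ h h' c
        rw [smul_add, opX_add]
        exact Subgroup.mul_mem _ (h c) (h' c)
      · intro r a _ h c
        rw [smul_smul]
        exact h _
    · intro a ha
      rw [← one_smul F a]
      refine Submodule.span_induction (p := fun a _ => ∀ c : F, opZ (c • a) ∈ bcStabilizer C₁ C₂)
        ?_ ?_ ?_ ?_ ha 1
      · rintro _ ⟨u, hu, w, hw, rfl⟩ c
        exact Subgroup.subset_closure
          (Or.inl ⟨c • u, (perp C₁).smul_mem c hu, w, hw, by rw [smul_latticeTensor]⟩)
      · intro c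
        simp
      · intro a a' _ _ h h' c
        rw [smul_add, opZ_add]
        exact Subgroup.mul_mem _ (h c) (h' c)
      · intro r a _ h c
        rw [smul_smul]
        exact h _

/-- Row patterns and column patterns split into their single rows and columns, so X(a) and Z(b) are
products of generators; the remaining factor of E is a scalar in the error group. The intersection
with `errorGroup` keeps out phases that are not themselves in that group. -/
lemma bcGauge_eq : bcGauge C₁ C₂ = errorGroup F (Fin n₁ × Fin n₂) ⊓
    weylSubgroup (rowSpace n₁ (perp C₂)) (colSpace n₂ (perp C₁)) := by
  apply le_antisymm
  · rw [bcGauge, Subgroup.closure_le]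
    rintro _ ((⟨hE, hs⟩ | ⟨p, hp, j, rfl⟩) | ⟨w, hw, i, rfl⟩)
    · refine ⟨hE, ?_⟩
      obtain ⟨t, a, -, b, -, h⟩ := errorGroup_le_weylSubgroup hE
      exact ⟨t, 0, Submodule.zero_mem _, 0, Submodule.zero_mem _,
        fun ψ => by simpa using (isScalarOp_of_weyl h hs).2 ψ⟩
    · exact ⟨opZ_mem_errorGroup _, cssGroup_le_weylSubgroup
        (opZ_mem_cssGroup (latticeTensor_mem_colSpace hp _))⟩
    · exact ⟨opX_mem_errorGroup _, cssGroup_le_weylSubgroup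
        (opX_mem_cssGroup (latticeTensor_mem_rowSpace hw _))⟩
  · rintro E ⟨hE, t, a, ha, b, hb, h⟩
    have hX : opX a ∈ bcGauge C₁ C₂ := by
      have : a = ∑ i, latticeTensor (Pi.single i 1) (fun j => a (i, j)) := by
        ext ⟨i, j⟩
        simp [latticeTensor, Finset.sum_apply, Pi.single_apply]
      rw [this]
      exact opX_mem_of_sum _ fun i _ => Subgroup.subset_closure (Or.inr ⟨_, ha i, i, rfl⟩)
    have hZ : opZ b ∈ bcGauge C₁ C₂ := by
      have : b = ∑ j, latticeTensor (fun i => b (i, j)) (Pi.single j 1) := by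
        ext ⟨i, j⟩
        simp [latticeTensor, Finset.sum_apply, Pi.single_apply]
      rw [this]
      exact opZ_mem_of_sum _ fun j _ =>
        Subgroup.subset_closure (Or.inl (Or.inr ⟨_, hb j, j, rfl⟩))
    have hs : E * (opX a * opZ b)⁻¹ ∈ bcGauge C₁ C₂ := by
      refine Subgroup.subset_closure (Or.inl (Or.inl ⟨Subgroup.mul_mem _ hE
        (Subgroup.inv_mem _ (opX_mul_opZ_mem_errorGroup a b)), phase t, fun ψ => ?_⟩))
      obtain ⟨φ, rfl⟩ := (opX a * opZ b).surjective ψ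
      have h1 : (opX a * opZ b)⁻¹ ((opX a * opZ b) φ) = φ :=
        (opX a * opZ b).symm_apply_apply φ
      change E ((opX a * opZ b)⁻¹ ((opX a * opZ b) φ)) = _
      rw [h1]
      exact h φ
    have := Subgroup.mul_mem _ hs (Subgroup.mul_mem _ hX hZ)
    rwa [inv_mul_cancel_right] at this

end BaconCasaccino

/-! ### Detectability and gauge action in terms of matrix elements -/

namespace HybridCode

variable {F : Type*} [Fintype F] {ι : Type*} [Fintype ι] [DecidableEq ι]
  {A B : Type*}

lemma transfer_apply [Fintype A] (Q : HybridCode F ι A B) (a b : B) (ψ : QuditSpace F ι) :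
    Q.transfer a b ψ = ∑ i, Inner.inner ℂ (Q.state (i, b)) ψ • Q.state (i, a) := by
  simp [transfer, InnerProductSpace.rankOne_apply]

lemma transfer_state [Fintype A] (Q : HybridCode F ι A B) (a b : B) (i : A) :
    Q.transfer a b (Q.state (i, b)) = Q.state (i, a) := by
  classical
  rw [transfer_apply, Finset.sum_eq_single i]
  · rw [orthonormal_iff_ite.1 Q.orthonormal, if_pos rfl, one_smul]
  · intro j _ hj
    rw [orthonormal_iff_ite.1 Q.orthonormal, if_neg (by simp [hj]), zero_smul]
  · simp

lemma compress_apply [Fintype A] (Q : HybridCode F ι A B) (E : QuditUnitary F ι) (a b : B)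
    (ψ : QuditSpace F ι) : Q.compress E a b ψ = Q.transfer a a (E (Q.transfer b b ψ)) := rfl

lemma inner_compress_state [Fintype A] (Q : HybridCode F ι A B) (E : QuditUnitary F ι) (a b : B)
    (i j : A) : Inner.inner ℂ (Q.state (i, a)) (Q.compress E a b (Q.state (j, b)))
      = Inner.inner ℂ (Q.state (i, a)) (E (Q.state (j, b))) := by
  classical
  rw [compress_apply, transfer_state, transfer_apply, inner_sum, Finset.sum_eq_single i]
  · rw [inner_smul_right, orthonormal_iff_ite.1 Q.orthonormal, if_pos rfl, mul_one]
  · intro k _ hk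
    rw [inner_smul_right, orthonormal_iff_ite.1 Q.orthonormal, if_neg (by simp [hk.symm]),
      mul_zero]
  · simp

/-- Both sides are determined by their matrix elements between the messages a and b; the inner
product on the right of the hypothesis is the Kronecker delta of i and j. -/
lemma compress_eq_smul_transfer [Fintype A] (Q : HybridCode F ι A B) {E : QuditUnitary F ι}
    {a b : B} {lam : ℂ}
    (h : ∀ i j, Inner.inner ℂ (Q.state (i, a)) (E (Q.state (j, b)))
      = lam * Inner.inner ℂ (Q.state (i, a)) (Q.state (j, a))) :
    Q.compress E a b = lam • Q.transfer a b := by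
  classical
  ext1 ψ
  rw [compress_apply, smul_apply, transfer_apply, transfer_apply,
    transfer_apply, Finset.smul_sum]
  refine Finset.sum_congr rfl fun i _ => ?_
  rw [map_sum, inner_sum, Finset.sum_eq_single i, smul_smul]
  · rw [map_smul, inner_smul_right, h, orthonormal_iff_ite.1 Q.orthonormal, if_pos rfl, mul_one,
      mul_comm]
  · intro j _ hj
    rw [map_smul, inner_smul_right, h, orthonormal_iff_ite.1 Q.orthonormal,
      if_neg (by simp [hj.symm]), mul_zero, mul_zero]
  · simp

lemma detectsClassical_of_inner_eq_zero [Fintype A] (Q : HybridCode F ι A B)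
    {E : QuditUnitary F ι} (h : ∀ a b, a ≠ b → ∀ i j,
      Inner.inner ℂ (Q.state (i, a)) (E (Q.state (j, b))) = 0) : Q.DetectsClassical E := by
  intro a b hab
  rw [Q.compress_eq_smul_transfer (lam := 0) fun i j => by rw [h a b hab, zero_mul]]
  ext1 ψ
  simp

lemma detectsQuantum_of_inner_eq_zero [Fintype A] (Q : HybridCode F ι A B)
    {E : QuditUnitary F ι} (h : ∀ k l, Inner.inner ℂ (Q.state k) (E (Q.state l)) = 0) :
    Q.DetectsQuantum E := fun a b =>
  ⟨0, Q.compress_eq_smul_transfer fun i j => by rw [h, zero_mul]⟩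

lemma DetectsQuantum.inner_eq [Fintype A] {Q : HybridCode F ι A B} {E : QuditUnitary F ι}
    (h : Q.DetectsQuantum E) (a b : B) : ∃ lam : ℂ, ∀ i j,
      Inner.inner ℂ (Q.state (i, a)) (E (Q.state (j, b)))
        = lam * Inner.inner ℂ (Q.state (i, a)) (Q.state (j, a)) := by
  obtain ⟨lam, hlam⟩ := h a b
  refine ⟨lam, fun i j => ?_⟩
  rw [← inner_compress_state, hlam, smul_apply, transfer_state,
    inner_smul_right]

/-- `E` acts on `A ⊗ B` as `1 ⊗ L` for some operator `L` on `B`. -/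
def ActsOnB [Fintype B] (Q : HybridCode F ι A B) (E : QuditUnitary F ι) : Prop :=
  ∃ L : Matrix B B ℂ, ∀ (i : A) (b : B), E (Q.state (i, b)) = ∑ b', L b' b • Q.state (i, b')

lemma ActsOnB.mul [Fintype B] {Q : HybridCode F ι A B} {E E' : QuditUnitary F ι}
    (h : Q.ActsOnB E) (h' : Q.ActsOnB E') : Q.ActsOnB (E * E') := by
  obtain ⟨L, hL⟩ := h
  obtain ⟨L', hL'⟩ := h'
  refine ⟨L * L', fun i b => ?_⟩
  change E (E' _) = _
  rw [hL', map_sum]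
  simp only [map_smul, hL, Finset.smul_sum, smul_smul, Matrix.mul_apply, Finset.sum_smul]
  rw [Finset.sum_comm]
  exact Finset.sum_congr rfl fun _ _ => Finset.sum_congr rfl fun _ _ => by rw [mul_comm]

lemma ActsOnB.of_smul [Fintype B] {Q : HybridCode F ι A B} {E E' : QuditUnitary F ι} {c : ℂ}
    (h : Q.ActsOnB E) (hE : ∀ ψ, E' ψ = c • E ψ) : Q.ActsOnB E' := by
  obtain ⟨L, hL⟩ := h
  refine ⟨c • L, fun i b => ?_⟩
  rw [hE, hL, Finset.smul_sum]
  simp [smul_smul]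

lemma actsOnB_of_monomial [Fintype B] {Q : HybridCode F ι A B} {E : QuditUnitary F ι}
    (h : ∀ b, ∃ (c : ℂ) (b' : B), ∀ i, E (Q.state (i, b)) = c • Q.state (i, b')) :
    Q.ActsOnB E := by
  classical
  choose c σ h using h
  refine ⟨fun b' b => if b' = σ b then c b else 0, fun i b => ?_⟩
  rw [h]
  simp

/-- Gauge operators leave A untouched, so λ is the matrix entry L a b. -/
lemma ActsOnB.detectsQuantum [Fintype A] [Fintype B] {Q : HybridCode F ι A B}
    {E : QuditUnitary F ι} (h : Q.ActsOnB E) : Q.DetectsQuantum E := by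
  classical
  obtain ⟨L, hL⟩ := h
  intro a b
  refine ⟨L a b, Q.compress_eq_smul_transfer fun i j => ?_⟩
  rw [hL, inner_sum, Finset.sum_eq_single a]
  · rw [inner_smul_right]
  · intro b' _ hb'
    rw [inner_smul_right, orthonormal_iff_ite.1 Q.orthonormal, if_neg (by simp [hb'.symm]),
      mul_zero]
  · simp

/-- Operators of the form `K ⊗ 1` and `1 ⊗ L` commute on `A ⊗ B`; two error operators
commute up to a phase, which must then be trivial. -/
lemma ActsOnB.eq_one_of_commute [Fintype B] {Q : HybridCode F ι A B} {E g : QuditUnitary F ι}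
    (h : Q.ActsOnB E) {μ : A → ℂ} {σ : A → A}
    (hg : ∀ i b, g (Q.state (i, b)) = μ i • Q.state (σ i, b)) {c : ℂ}
    (hc : ∀ ψ, g (E ψ) = c • E (g ψ)) [Nonempty A] [Nonempty B] : c = 1 := by
  obtain ⟨L, hL⟩ := h
  obtain ⟨i⟩ := ‹Nonempty A›
  obtain ⟨b⟩ := ‹Nonempty B›
  have h1 : g (E (Q.state (i, b))) = E (g (Q.state (i, b))) := by
    rw [hg, map_smul, hL, hL, map_sum, Finset.smul_sum]
    exact Finset.sum_congr rfl fun b' _ => by rw [map_smul, hg, smul_comm]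
  have h2 : E (g (Q.state (i, b))) ≠ 0 := by
    rw [Ne, LinearIsometryEquiv.map_eq_zero_iff, LinearIsometryEquiv.map_eq_zero_iff]
    exact Q.orthonormal.ne_zero _
  rw [hc] at h1
  exact smul_left_injective ℂ h2 (h1.trans (one_smul ℂ _).symm)

end HybridCode

/-! Hybrid codes obtained from CSS subsystem codes by gauge fixing. -/

section CosetState

variable {F : Type*} [Field F] [Fintype F] {ι : Type*} [Fintype ι] [DecidableEq ι]

/-- Eigenvectors of a unitary for different eigenvalues are orthogonal. All orthogonality relations
between basis states and their images under errors come from this. -/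
lemma inner_eq_zero_of_phase {g : QuditUnitary F ι} {ψ φ : QuditSpace F ι} {s s' : F}
    (hψ : g ψ = phase s • ψ) (hφ : g φ = phase s' • φ) (h : phase (s' - s) ≠ 1) :
    inner ℂ ψ φ = 0 := by
  have h1 : inner ℂ (g ψ) (g φ) = inner ℂ ψ φ := g.inner_map_map ψ φ
  rw [hψ, hφ, inner_smul_left, inner_smul_right, ← mul_assoc] at h1
  have h2 : starRingEnd ℂ (phase s) * phase s' = phase (s' - s) := by
    have : phase s' = phase s * phase (s' - s) := by rw [← phase_add, add_sub_cancel]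
    rw [this, ← mul_assoc, phase_mul_conj, one_mul]
  rw [h2] at h1
  by_contra h0
  exact h (mul_right_cancel₀ h0 (h1.trans (one_mul _).symm))

open Classical in
/-- The indicator function of `T`. -/
def indicatorState (T : Submodule F (ι → F)) : QuditSpace F ι :=
  WithLp.toLp 2 fun x => if x ∈ T then 1 else 0

lemma indicatorState_ne_zero (T : Submodule F (ι → F)) : indicatorState T ≠ 0 := fun h => by
  have := congrArg (fun φ : QuditSpace F ι => φ 0) h
  simp [indicatorState] at this

/-- `|T|^{-1/2} ∑ t ∈ T, ω ^ Tr (χ · t) |z + t⟩`. -/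
def cosetState (T : Submodule F (ι → F)) (z χ : ι → F) : QuditSpace F ι :=
  opX z (opZ χ ((‖indicatorState T‖⁻¹ : ℂ) • indicatorState T))

variable {T : Submodule F (ι → F)}

lemma norm_cosetState (z χ : ι → F) : ‖cosetState T z χ‖ = 1 := by
  rw [cosetState, LinearIsometryEquiv.norm_map, LinearIsometryEquiv.norm_map, norm_smul, norm_inv,
    Complex.norm_real, norm_norm, inv_mul_cancel₀ (norm_ne_zero_iff.2 (indicatorState_ne_zero T))]

lemma opX_cosetState (a z χ : ι → F) : opX a (cosetState T z χ) = cosetState T (z + a) χ := by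
  rw [cosetState, opX_opX, add_comm, cosetState]

lemma opZ_cosetState (b z χ : ι → F) :
    opZ b (cosetState T z χ) = phase (b ⬝ᵥ z) • cosetState T z (χ + b) := by
  rw [cosetState, opZ_opX, opZ_opZ, add_comm b, cosetState]

/-- The indicator of T is invariant under X(t); moving X(t) past Z(χ) leaves the phase. Together
with `cosetState_add_right`, up to phase only z modulo T and χ modulo T^⊥ matter. -/
lemma cosetState_add_left {t : ι → F} (ht : t ∈ T) (z χ : ι → F) :
    cosetState T (z + t) χ = phase (-(χ ⬝ᵥ t)) • cosetState T z χ := by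
  have h : opX t (indicatorState T) = indicatorState T := by
    ext x
    rw [opX_apply]
    have hx : x - t ∈ T ↔ x ∈ T := T.sub_mem_iff_left ht
    by_cases hxT : x ∈ T
    · simp [indicatorState, hxT, hx.2 hxT]
    · simp [indicatorState, hxT, mt hx.1 hxT]
  rw [cosetState, ← opX_opX, opX_opZ, map_smul, map_smul, h, cosetState, map_smul, map_smul]

lemma cosetState_add_right {b : ι → F} (hb : b ∈ perp T) (z χ : ι → F) :
    cosetState T z (χ + b) = cosetState T z χ := by
  have h : opZ b (indicatorState T) = indicatorState T := by
    ext x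
    rw [opZ_apply]
    by_cases hx : x ∈ T
    · simp [mem_perp'.1 hb x hx]
    · simp [indicatorState, hx]
  rw [cosetState, ← opZ_opZ, map_smul, h, cosetState]

end CosetState

/-! ### Basis states of a CSS gauge fixing and their symmetries -/

section GaugeFixing

lemma QuditUnitary.mul_apply {F ι : Type*} [Fintype F] [Fintype ι] [DecidableEq ι]
    (E E' : QuditUnitary F ι) (ψ : QuditSpace F ι) :
    (E * E') ψ = E (E' ψ) := rfl

lemma QuditUnitary.mem_centralizer_of_scalar {F ι : Type*} [Fintype F] [Fintype ι]
    [DecidableEq ι] {E : QuditUnitary F ι} {c : ℂ} (hE : ∀ ψ, E ψ = c • ψ)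
    (S : Set (QuditUnitary F ι)) : E ∈ Subgroup.centralizer S :=
  Subgroup.mem_centralizer_iff.2 fun g _ => LinearIsometryEquiv.ext fun ψ => by
    rw [QuditUnitary.mul_apply, QuditUnitary.mul_apply, hE, hE, map_smul]

lemma exists_disjoint_sup_eq {K V : Type*} [DivisionRing K] [AddCommGroup V] [Module K V]
    {N W : Submodule K V} (h : N ≤ W) : ∃ U : Submodule K V, Disjoint U N ∧ U ⊔ N = W := by
  obtain ⟨U, hU⟩ := Submodule.exists_isCompl N
  refine ⟨U ⊓ W, hU.symm.disjoint.mono_left inf_le_left, ?_⟩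
  rw [sup_comm, ← sup_inf_assoc_of_le U h, hU.sup_eq_top, top_inf_eq]

variable {F : Type*} [Field F] [Fintype F] {ι : Type*} [Fintype ι] [DecidableEq ι]

/-- The data of a CSS gauge fixing of the subsystem code with gauge operators `X(r)`, `r ∈ R`, and
`Z(b)`, `b ∈ M^⊥`: the operators `X(t)`, `t ∈ T`, and the `Z(b)`, `b ∈ M^⊥ ∩ T^⊥`, are adjoined
to the stabilizer; `A`, `B` and `D` are systems of representatives. -/
structure CSSGaugeFixing (M R T A B D : Submodule F (ι → F)) : Prop where
  inf_le : M ⊓ R ≤ T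
  le : T ≤ R
  disjoint_A : Disjoint A (M ⊓ R)
  sup_A : A ⊔ (M ⊓ R) = M
  disjoint_B : Disjoint B T
  sup_B : B ⊔ T = R
  disjoint_D : Disjoint D (perp M ⊓ perp T)
  sup_D : D ⊔ (perp M ⊓ perp T) = perp M

namespace CSSGaugeFixing

variable {M R T A B D : Submodule F (ι → F)} (h : CSSGaugeFixing M R T A B D)

section
omit [Fintype F] [DecidableEq ι]
include h

lemma A_le : A ≤ M := le_sup_left.trans h.sup_A.le

lemma B_le : B ≤ R := le_sup_left.trans h.sup_B.le

lemma D_le : D ≤ perp M := le_sup_left.trans h.sup_D.le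

lemma eq_zero_of_mem_A {α : ι → F} (hα : α ∈ A) (hR : α ∈ R) : α = 0 :=
  Submodule.disjoint_def.1 h.disjoint_A α hα ⟨h.A_le hα, hR⟩

/-- If β = m + t, then m = β - t lies in M ∩ R ≤ T, so β ∈ T. Thus B remains independent of the
larger space M + T, which lets Z(M^⊥ ∩ T^⊥) distinguish the elements of B. -/
lemma eq_zero_of_mem_B {β : ι → F} (hβ : β ∈ B) (hM : β ∈ M ⊔ T) : β = 0 := by
  refine Submodule.disjoint_def.1 h.disjoint_B β hβ ?_
  obtain ⟨m, hm, t, ht, rfl⟩ := Submodule.mem_sup.1 hM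
  have : m ∈ R := by simpa using R.sub_mem (h.B_le hβ) (h.le ht)
  exact T.add_mem (h.inf_le ⟨hm, this⟩) ht

lemma eq_zero_of_mem_D {χ : ι → F} (hχ : χ ∈ D) (hT : χ ∈ perp T) : χ = 0 :=
  Submodule.disjoint_def.1 h.disjoint_D χ hχ ⟨h.D_le hχ, hT⟩

end

variable {κ κ' : Type*} (eA : κ ≃ A) (eB : κ' ≃ B × D)

/-- The basis state of the hybrid code. -/
def basisState (T : Submodule F (ι → F)) (eA : κ ≃ A) (eB : κ' ≃ B × D) (k : κ × κ') :
    QuditSpace F ι :=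
  cosetState T ((eA k.1 : ι → F) + (eB k.2).1) (eB k.2).2

/-- The diagonal operators read off the labels: X(T) reads χ, Z(M^⊥ ∩ T^⊥) reads β and Z(R^⊥) reads
α. The operators X(A), X(B) and Z(D) shift α, β and χ. -/
lemma opX_basisState_of_mem_T {t : ι → F} (ht : t ∈ T) (k : κ × κ') :
    opX t (basisState T eA eB k)
      = phase (-(((eB k.2).2 : ι → F) ⬝ᵥ t)) • basisState T eA eB k := by
  rw [basisState, opX_cosetState, cosetState_add_left ht]

lemma opZ_basisState_of_mem_perp_T {b : ι → F} (hb : b ∈ perp T) (k : κ × κ') :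
    opZ b (basisState T eA eB k)
      = phase (b ⬝ᵥ (eA k.1 : ι → F) + b ⬝ᵥ ((eB k.2).1 : ι → F)) • basisState T eA eB k := by
  rw [basisState, opZ_cosetState, cosetState_add_right hb, dotProduct_add]

lemma opX_basisState_of_mem_A (α : A) (k : κ × κ') :
    opX (α : ι → F) (basisState T eA eB k)
      = basisState T eA eB (eA.symm (eA k.1 + α), k.2) := by
  rw [basisState, opX_cosetState, basisState]
  simp only [Equiv.apply_symm_apply, Submodule.coe_add]
  rw [add_right_comm]

lemma opX_basisState_of_mem_B (β : B) (k : κ × κ') :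
    opX (β : ι → F) (basisState T eA eB k)
      = basisState T eA eB (k.1, eB.symm ((eB k.2).1 + β, (eB k.2).2)) := by
  rw [basisState, opX_cosetState, basisState]
  simp only [Equiv.apply_symm_apply, Submodule.coe_add]
  rw [add_assoc]

include h

lemma opX_basisState_of_mem_inf {n : ι → F} (hn : n ∈ M ⊓ R) (k : κ × κ') :
    opX n (basisState T eA eB k) = basisState T eA eB k := by
  rw [opX_basisState_of_mem_T eA eB (h.inf_le hn),
    mem_perp'.1 (h.D_le (eB k.2).2.2) n hn.1, neg_zero, phase_zero, one_smul]

lemma opZ_basisState_of_mem_inf {b : ι → F} (hb : b ∈ perp M ⊓ perp T) (k : κ × κ') :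
    opZ b (basisState T eA eB k)
      = phase (b ⬝ᵥ ((eB k.2).1 : ι → F)) • basisState T eA eB k := by
  rw [opZ_basisState_of_mem_perp_T eA eB hb.2, mem_perp'.1 hb.1 _ (h.A_le (eA k.1).2), zero_add]

lemma opZ_basisState_of_mem_perp_R {b : ι → F} (hb : b ∈ perp R) (k : κ × κ') :
    opZ b (basisState T eA eB k)
      = phase (b ⬝ᵥ (eA k.1 : ι → F)) • basisState T eA eB k := by
  rw [opZ_basisState_of_mem_perp_T eA eB (perp_anti h.le hb),
    mem_perp'.1 hb _ (h.B_le (eB k.2).1.2), add_zero]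

lemma opZ_basisState_of_mem_D (χ : D) (k : κ × κ') :
    opZ (χ : ι → F) (basisState T eA eB k) = phase ((χ : ι → F) ⬝ᵥ ((eB k.2).1 : ι → F)) •
      basisState T eA eB (k.1, eB.symm ((eB k.2).1, (eB k.2).2 + χ)) := by
  rw [basisState, opZ_cosetState, basisState, dotProduct_add,
    mem_perp'.1 (h.D_le χ.2) _ (h.A_le (eA k.1).2), zero_add]
  simp only [Equiv.apply_symm_apply, Submodule.coe_add]

/-- Operators that commute with the stabilizer of the inner code do not change the classical
message. -/
lemma inner_basisState_eq_zero_of_commute {a b : ι → F} (ha : a ∈ M ⊔ T) (hb : b ∈ perp T)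
    {k l : κ × κ'} (hkl : k.2 ≠ l.2) :
    inner ℂ (basisState T eA eB k) (opX a (opZ b (basisState T eA eB l))) = 0 := by
  by_cases hχ : (eB k.2).2 = (eB l.2).2
  -- Equal χ forces different β, which some Z(b') in the inner stabilizer tells apart. As a ∈ M + T,
  -- the error commutes with Z(b') and preserves the eigenvalue.
  · have hβ : ((eB l.2).1 - (eB k.2).1 : ι → F) ∉ perp (perp M ⊓ perp T) := fun hβ => by
      rw [perp_inf_perp] at hβ
      have := h.eq_zero_of_mem_B (B.sub_mem (eB l.2).1.2 (eB k.2).1.2) hβ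
      exact hkl (eB.injective (Prod.ext (Subtype.ext (sub_eq_zero.1 this)).symm hχ))
    obtain ⟨b', hb', hne⟩ := exists_phase_dotProduct_ne_one hβ
    refine inner_eq_zero_of_phase (h.opZ_basisState_of_mem_inf eA eB hb' k)
      (s' := b' ⬝ᵥ ((eB l.2).1 : ι → F)) ?_ (by rwa [← dotProduct_sub])
    rw [opZ_opX, opZ_opZ, add_comm, ← opZ_opZ, h.opZ_basisState_of_mem_inf eA eB hb', map_smul,
      map_smul]
    rw [← perp_perp (M ⊔ T), perp_sup] at ha
    rw [mem_perp.1 ha b' hb', phase_zero, one_smul]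
  -- Different χ are told apart by some X(t) with t ∈ T, which commutes with the error because b ∈
  -- T^⊥.
  · have hχ' : ((eB k.2).2 - (eB l.2).2 : ι → F) ∉ perp T := fun hT => by
      have := h.eq_zero_of_mem_D (D.sub_mem (eB k.2).2.2 (eB l.2).2.2) hT
      exact hχ (Subtype.ext (sub_eq_zero.1 this))
    obtain ⟨t, ht, hne⟩ := exists_phase_dotProduct_ne_one hχ'
    refine inner_eq_zero_of_phase (opX_basisState_of_mem_T eA eB ht k)
      (s' := -(((eB l.2).2 : ι → F) ⬝ᵥ t)) ?_ ?_
    · rw [opX_opX, add_comm, ← opX_opX, opX_opZ, opX_basisState_of_mem_T eA eB ht, map_smul,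
        mem_perp'.1 hb t ht, neg_zero, phase_zero, one_smul, map_smul, map_smul]
    · rw [dotProduct_comm, sub_dotProduct] at hne
      rwa [neg_sub_neg]

/-- Different messages are the case of the trivial error above. Within one message α differs, and A
∩ R = 0 provides a separating Z(b) with b ∈ R^⊥. -/
lemma orthonormal_basisState : Orthonormal ℂ (basisState T eA eB) := by
  refine ⟨fun k => norm_cosetState _ _, fun k l hkl => ?_⟩
  change inner ℂ (basisState T eA eB k) (basisState T eA eB l) = 0
  by_cases h2 : k.2 = l.2
  · have hα : ((eA l.1) - (eA k.1) : ι → F) ∉ R := fun hR => by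
      have := h.eq_zero_of_mem_A (A.sub_mem (eA l.1).2 (eA k.1).2) hR
      exact hkl (Prod.ext (eA.injective (Subtype.ext (sub_eq_zero.1 this))).symm h2)
    obtain ⟨b, hb, hne⟩ := exists_phase_dotProduct_ne_one' hα
    exact inner_eq_zero_of_phase (h.opZ_basisState_of_mem_perp_R eA eB hb k)
      (h.opZ_basisState_of_mem_perp_R eA eB hb l) (by rwa [← dotProduct_sub])
  · simpa using h.inner_basisState_eq_zero_of_commute eA eB (M ⊔ T).zero_mem (perp T).zero_mem h2

/-- The hybrid code obtained by gauge fixing. -/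
def code : HybridCode F ι κ κ' := ⟨basisState T eA eB, h.orthonormal_basisState eA eB⟩

lemma code_state (k : κ × κ') : (h.code eA eB).state k = basisState T eA eB k := rfl

/-- Operators that do not commute with the stabilizer are detected. -/
lemma inner_basisState_eq_zero_of_not_commute {a b : ι → F}
    (hab : ¬ (a ∈ M ⊔ R ∧ b ∈ perp (M ⊓ R)))
    (k l : κ × κ') :
    inner ℂ (basisState T eA eB k) (opX a (opZ b (basisState T eA eB l))) = 0 := by
  rw [not_and_or] at hab
  rcases hab with ha | hb
  · rw [← perp_inf_perp] at ha
    -- The stabilizer element Z(b') fixes both basis states but picks up a nontrivial phase when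
    -- moved past the error.
    obtain ⟨b', hb', hne⟩ := exists_phase_dotProduct_ne_one ha
    have hb'' : b' ∈ perp M ⊓ perp T := ⟨hb'.1, perp_anti h.le hb'.2⟩
    have h0 : ∀ k : κ × κ', opZ b' (basisState T eA eB k) = basisState T eA eB k := fun k => by
      rw [h.opZ_basisState_of_mem_inf eA eB hb'', mem_perp'.1 hb'.2 _ (h.B_le (eB k.2).1.2),
        phase_zero, one_smul]
    refine inner_eq_zero_of_phase (g := opZ b') (s := 0) (s' := b' ⬝ᵥ a)
      (by rw [h0, phase_zero, one_smul]) ?_ (by rwa [sub_zero])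
    rw [opZ_opX, opZ_opZ, add_comm, ← opZ_opZ, h0]
  · obtain ⟨n, hn, hne⟩ := exists_phase_dotProduct_ne_one hb
    refine inner_eq_zero_of_phase (g := opX n) (s := 0) (s' := -(b ⬝ᵥ n))
      (by rw [h.opX_basisState_of_mem_inf eA eB hn, phase_zero, one_smul]) ?_ ?_
    · rw [opX_opX, add_comm, ← opX_opX, opX_opZ, h.opX_basisState_of_mem_inf eA eB hn, map_smul]
    · rwa [sub_zero, phase_neg, Ne, inv_eq_one, dotProduct_comm]

/-! The outer code and the inner codes. -/

omit [Fintype F] [DecidableEq ι] in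
lemma finrank_A_add : finrank F A + finrank F (M ⊓ R : Submodule F (ι → F)) = finrank F M := by
  have := Submodule.finrank_sup_add_finrank_inf_eq A (M ⊓ R)
  rw [h.sup_A, h.disjoint_A.eq_bot, finrank_bot] at this
  lia

omit [Fintype F] [DecidableEq ι] in
-- Here dim B = dim R - dim T and dim D = dim(M + T) - dim M = dim T - dim(M ∩ R), since M ∩ T = M ∩
-- R. The sum does not depend on T.
lemma finrank_B_add_finrank_D_add :
    finrank F B + finrank F D + finrank F (M ⊓ R : Submodule F (ι → F)) = finrank F R := by
  have h1 := Submodule.finrank_sup_add_finrank_inf_eq B T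
  rw [h.sup_B, h.disjoint_B.eq_bot, finrank_bot] at h1
  have h2 := Submodule.finrank_sup_add_finrank_inf_eq D (perp M ⊓ perp T)
  rw [h.sup_D, h.disjoint_D.eq_bot, finrank_bot, ← perp_sup, finrank_perp, finrank_perp] at h2
  have h3 := Submodule.finrank_sup_add_finrank_inf_eq M T
  have h4 : M ⊓ T = M ⊓ R := le_antisymm (inf_le_inf_left M h.le) (le_inf inf_le_left h.inf_le)
  rw [h4] at h3
  have h5 := Submodule.finrank_le (M ⊔ T)
  rw [Module.finrank_fintype_fun_eq_card] at h5
  have h6 := Submodule.finrank_mono (le_sup_left : M ≤ M ⊔ T)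
  lia

omit h in
include eA in
lemma card_A [Fintype κ] : Fintype.card κ = Fintype.card F ^ finrank F A := by
  classical
  rw [Fintype.card_congr eA, Module.card_eq_pow_finrank (K := F)]

omit h in
include eB in
lemma card_B_prod_D [Fintype κ'] :
    Fintype.card κ' = Fintype.card F ^ (finrank F B + finrank F D) := by
  classical
  rw [Fintype.card_congr eB, Fintype.card_prod, Module.card_eq_pow_finrank (K := F) (V := B),
    Module.card_eq_pow_finrank (K := F) (V := D), pow_add]

/-- The stabilizer of the subsystem code. -/
lemma outer_code [Fintype κ] [Fintype κ'] :
    (h.code eA eB).outer = fixedSpace (cssGroup (M ⊓ R) (perp M ⊓ perp R)) := by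
  -- A complement U of M ∩ R in M + R has dimension dim M + dim R - 2 dim(M ∩ R) = dim A + dim B +
  -- dim D, so the upper bound equals the number of basis states.
  obtain ⟨U, hU, hU'⟩ := exists_disjoint_sup_eq (inf_le_left.trans le_sup_left : M ⊓ R ≤ M ⊔ R)
  refine Submodule.eq_of_le_of_finrank_le (Submodule.span_le.2 ?_) ?_
  · rintro _ ⟨k, rfl⟩
    refine mem_fixedSpace_cssGroup.2 ⟨fun n hn => h.opX_basisState_of_mem_inf eA eB hn k,
      fun b hb => ?_⟩
    rw [code_state, h.opZ_basisState_of_mem_perp_R eA eB hb.2,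
      mem_perp'.1 hb.1 _ (h.A_le (eA k.1).2), phase_zero, one_smul]
  · refine (finrank_fixedSpace_cssGroup_le (U := U) ?_).trans ?_
    · rw [perp_inf_perp, hU']
    · rw [HybridCode.outer, finrank_span_eq_card (h.code eA eB).orthonormal.linearIndependent,
        Fintype.card_prod, card_A eA, card_B_prod_D eB, ← pow_add]
      refine Nat.pow_le_pow_right Fintype.card_pos ?_
      have h1 := Submodule.finrank_sup_add_finrank_inf_eq U (M ⊓ R)
      have h2 := Submodule.finrank_sup_add_finrank_inf_eq M R
      rw [hU', hU.eq_bot, finrank_bot] at h1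
      have := h.finrank_A_add
      have := h.finrank_B_add_finrank_D_add
      lia

/-- Message 0 has β = χ = 0, where all inner stabilizer phases vanish. The dimension bound applies
with U = A because M + T = A + T. -/
lemma inner_code_zero [Fintype κ] :
    (h.code eA eB).inner (eB.symm 0) = fixedSpace (cssGroup T (perp M ⊓ perp T)) := by
  refine Submodule.eq_of_le_of_finrank_le (Submodule.span_le.2 ?_) ?_
  · rintro _ ⟨i, rfl⟩
    refine mem_fixedSpace_cssGroup.2 ⟨fun t ht => ?_, fun b hb => ?_⟩
    · exact (opX_basisState_of_mem_T eA eB ht _).trans (by simp [code_state])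
    · exact (h.opZ_basisState_of_mem_inf eA eB hb _).trans (by simp [code_state])
  · refine (finrank_fixedSpace_cssGroup_le (U := A) ?_).trans ?_
    · rw [perp_inf_perp]
      refine sup_le ?_ le_sup_right
      rw [← h.sup_A]
      exact sup_le_sup_left h.inf_le A
    · rw [HybridCode.inner, finrank_span_eq_card, card_A eA]
      exact (h.code eA eB).orthonormal.linearIndependent.comp _ fun i j hij => by simpa using hij

omit h in
/-- The translation operators of the hybrid code. -/
def translation (eB : κ' ≃ B × D) (k : κ') : QuditUnitary F ι :=
  opX ((eB k).1 : ι → F) * opZ ((eB k).2 : ι → F)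

lemma translation_basisState (i : κ) (k : κ') :
    translation eB k (basisState T eA eB (i, eB.symm 0)) = basisState T eA eB (i, k) := by
  change opX _ (opZ _ _) = _
  rw [h.opZ_basisState_of_mem_D eA eB, map_smul, opX_basisState_of_mem_B eA eB]
  simp

lemma inner_code [Fintype κ] (k : κ') : (h.code eA eB).inner k =
    (fixedSpace (cssGroup T (perp M ⊓ perp T))).map
      ((translation eB k).toLinearEquiv : QuditSpace F ι →ₗ[ℂ] QuditSpace F ι) := by
  rw [← h.inner_code_zero eA eB, HybridCode.inner, HybridCode.inner, Submodule.map_span,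
    ← Set.range_comp]
  congr 2
  ext1 i
  exact (h.translation_basisState eA eB i k).symm

/-- If two translations differed by an element of the centralizer, which preserves C₀, a state of
one message would lie in the inner code of another, against orthogonality. Translations multiply by
adding labels, up to a scalar, and scalars are in the centralizer. -/
lemma isHybridStabilizerCode [Fintype κ] [Fintype κ'] :
    (h.code eA eB).IsHybridStabilizerCode (cssGroup (M ⊓ R) (perp M ⊓ perp R))
      (cssGroup T (perp M ⊓ perp T)) (translation eB) := by
  refine ⟨isStabilizerGroup_cssGroup (inf_le_left.trans (perp_anti inf_le_left)),
    isStabilizerGroup_cssGroup inf_le_right,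
    cssGroup_mono h.inf_le (inf_le_inf_left _ (perp_anti h.le)), h.outer_code eA eB,
    fun k => opX_mul_opZ_mem_errorGroup _ _, ⟨eB.symm 0, by simp [translation]⟩, ?_, ?_,
    h.inner_code eA eB⟩
  · intro k k' hk hE
    set E := (translation eB k)⁻¹ * translation eB k' with hEdef
    let i := eA.symm 0
    have h0 : basisState T eA eB (i, eB.symm 0) ∈ fixedSpace (cssGroup T (perp M ⊓ perp T)) := by
      rw [← h.inner_code_zero eA eB]
      exact Submodule.subset_span ⟨i, rfl⟩
    have h1 : E (basisState T eA eB (i, eB.symm 0)) ∈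
        fixedSpace (cssGroup T (perp M ⊓ perp T)) := fun g hg => by
      have hgE : g * E = E * g := Subgroup.mem_centralizer_iff.1 hE g hg
      have := congrArg (fun f : QuditUnitary F ι => f (basisState T eA eB (i, eB.symm 0))) hgE
      exact this.trans (congrArg E (h0 g hg))
    have h2 : basisState T eA eB (i, k') ∈ (h.code eA eB).inner k := by
      rw [h.inner_code eA eB]
      refine ⟨_, h1, ?_⟩
      have : translation eB k * E = translation eB k' := by rw [hEdef, mul_inv_cancel_left]
      rw [← h.translation_basisState eA eB i k', ← this]
      rfl
    have h3 : (h.code eA eB).inner k ≤ (ℂ ∙ basisState T eA eB (i, k'))ᗮ := by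
      rw [HybridCode.inner, Submodule.span_le]
      rintro _ ⟨j, rfl⟩
      rw [SetLike.mem_coe, Submodule.mem_orthogonal_singleton_iff_inner_right]
      exact (h.code eA eB).orthonormal.2 (by simp [hk.symm])
    have h4 := Submodule.mem_orthogonal_singleton_iff_inner_right.1 (h3 h2)
    exact (h.code eA eB).orthonormal.ne_zero (i, k') (inner_self_eq_zero.1 h4)
  · intro k k'
    refine ⟨eB.symm (eB k + eB k'), QuditUnitary.mem_centralizer_of_scalar
      (c := phase (((eB k).2 : ι → F) ⬝ᵥ ((eB k').1 : ι → F))) (fun ψ => ?_) _⟩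
    have h1 := weyl_mul 0 0 ((eB k).1 : ι → F) (eB k').1 (eB k).2 (eB k').2 ψ
    simp only [phase_zero, one_smul, add_zero, zero_add] at h1
    rw [QuditUnitary.mul_apply, QuditUnitary.mul_apply]
    simp only [translation, Equiv.apply_symm_apply, QuditUnitary.mul_apply]
    rw [h1, map_smul]
    exact congrArg _ (LinearIsometryEquiv.symm_apply_apply
      (opX ((eB k + eB k').1 : ι → F) * opZ ((eB k + eB k').2 : ι → F)) ψ)

/-! The gauge group. -/

omit h in
lemma _root_.opX_weyl {E : QuditUnitary F ι} {t : F} {a b : ι → F}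
    (hE : ∀ ψ, E ψ = phase t • opX a (opZ b ψ)) (m : ι → F) (ψ : QuditSpace F ι) :
    opX m (E ψ) = phase (-(b ⬝ᵥ m)) • E (opX m ψ) := by
  rw [hE, hE, map_smul, opX_opX, add_comm, ← opX_opX, opX_opZ m, map_smul, smul_comm]

omit h in
lemma _root_.opZ_weyl {E : QuditUnitary F ι} {t : F} {a b : ι → F}
    (hE : ∀ ψ, E ψ = phase t • opX a (opZ b ψ)) (c : ι → F) (ψ : QuditSpace F ι) :
    opZ c (E ψ) = phase (c ⬝ᵥ a) • E (opZ c ψ) := by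
  rw [hE, hE, map_smul, opZ_opX, opZ_opZ, add_comm, ← opZ_opZ, smul_comm]

/-- Splitting a along B + T and b along D + (M^⊥ ∩ T^⊥) leaves four factors; each sends a basis
state to a multiple of another with the same index i, and neither the multiple nor the new message
depends on i. -/
lemma actsOnB_of_mem [Fintype κ'] {E : QuditUnitary F ι}
    (hE : E ∈ weylSubgroup R (perp M)) : (h.code eA eB).ActsOnB E := by
  obtain ⟨t, a, ha, b, hb, hE⟩ := hE
  rw [← h.sup_B] at ha
  rw [← h.sup_D] at hb
  obtain ⟨β, hβ, s, hs, rfl⟩ := Submodule.mem_sup.1 ha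
  obtain ⟨χ, hχ, c, hc, rfl⟩ := Submodule.mem_sup.1 hb
  have h1 : (h.code eA eB).ActsOnB (opX β) := HybridCode.actsOnB_of_monomial fun k =>
    ⟨1, eB.symm ((eB k).1 + ⟨β, hβ⟩, (eB k).2), fun i => by
      rw [code_state, one_smul]
      exact opX_basisState_of_mem_B eA eB ⟨β, hβ⟩ (i, k)⟩
  have h2 : (h.code eA eB).ActsOnB (opX s) := HybridCode.actsOnB_of_monomial fun k =>
    ⟨phase (-(((eB k).2 : ι → F) ⬝ᵥ s)), k, fun i => by
      rw [code_state, opX_basisState_of_mem_T eA eB hs (i, k)]⟩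
  have h3 : (h.code eA eB).ActsOnB (opZ χ) := HybridCode.actsOnB_of_monomial fun k =>
    ⟨phase (χ ⬝ᵥ ((eB k).1 : ι → F)), eB.symm ((eB k).1, (eB k).2 + ⟨χ, hχ⟩), fun i => by
      rw [code_state, code_state]
      exact h.opZ_basisState_of_mem_D eA eB ⟨χ, hχ⟩ (i, k)⟩
  have h4 : (h.code eA eB).ActsOnB (opZ c) := HybridCode.actsOnB_of_monomial fun k =>
    ⟨phase (c ⬝ᵥ ((eB k).1 : ι → F)), k, fun i => by
      rw [code_state, h.opZ_basisState_of_mem_inf eA eB hc (i, k)]⟩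
  refine ((h1.mul h2).mul (h3.mul h4)).of_smul (c := phase t) fun ψ => ?_
  rw [hE, ← opX_add, ← opZ_add, QuditUnitary.mul_apply]

lemma opX_basisState_of_mem_M {m : ι → F} (hm : m ∈ M) :
    ∃ σ : κ → κ, ∀ i k, opX m (basisState T eA eB (i, k)) = basisState T eA eB (σ i, k) := by
  rw [← h.sup_A] at hm
  obtain ⟨α, hα, n, hn, rfl⟩ := Submodule.mem_sup.1 hm
  refine ⟨fun i => eA.symm (eA i + ⟨α, hα⟩), fun i k => ?_⟩
  rw [← opX_opX, h.opX_basisState_of_mem_inf eA eB hn]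
  exact opX_basisState_of_mem_A eA eB ⟨α, hα⟩ (i, k)

/-- The operators Z(R^⊥) and X(M) act on A alone, so they commute with E on the code. Trivial
commutation phases mean a ∈ R^⊥⊥ = R and b ∈ M^⊥. -/
lemma mem_of_actsOnB [Fintype κ'] {E : QuditUnitary F ι} (hE : E ∈ errorGroup F ι)
    (hB : (h.code eA eB).ActsOnB E) : E ∈ weylSubgroup R (perp M) := by
  obtain ⟨t, a, -, b, -, hE⟩ := errorGroup_le_weylSubgroup hE
  have : Nonempty κ := ⟨eA.symm 0⟩
  have : Nonempty κ' := ⟨eB.symm 0⟩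
  refine ⟨t, a, ?_, b, ?_, hE⟩
  · by_contra ha
    obtain ⟨c, hc, hne⟩ := exists_phase_dotProduct_ne_one' ha
    exact hne (hB.eq_one_of_commute (μ := fun i => phase (c ⬝ᵥ (eA i : ι → F))) (σ := id)
      (fun i k => h.opZ_basisState_of_mem_perp_R eA eB hc (i, k)) (opZ_weyl hE c))
  · by_contra hb
    obtain ⟨m, hm, hne⟩ := exists_phase_dotProduct_ne_one hb
    obtain ⟨σ, hσ⟩ := h.opX_basisState_of_mem_M eA eB hm
    have := hB.eq_one_of_commute (μ := fun _ => 1) (σ := σ)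
      (fun i k => (hσ i k).trans (one_smul ℂ _).symm) (opX_weyl hE m)
    rw [phase_neg, inv_eq_one, dotProduct_comm] at this
    exact hne this

lemma isGaugeFixing [Fintype κ] [Fintype κ'] :
    (h.code eA eB).IsGaugeFixing (cssGroup (M ⊓ R) (perp M ⊓ perp R))
      (errorGroup F ι ⊓ weylSubgroup R (perp M)) := by
  refine ⟨⟨isStabilizerGroup_cssGroup (inf_le_left.trans (perp_anti inf_le_left)),
    h.outer_code eA eB, fun E => ⟨fun hE => ⟨hE.1, h.actsOnB_of_mem eA eB hE.2⟩,
      fun hE => ⟨hE.1, h.mem_of_actsOnB eA eB hE.1 hE.2⟩⟩⟩, _, _,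
    h.isHybridStabilizerCode eA eB, ?_, fun k => ⟨opX_mul_opZ_mem_errorGroup _ _, 0, _,
      h.B_le (eB k).1.2, _, h.D_le (eB k).2.2, fun ψ => by simp [translation]⟩⟩
  refine cssGroup_le.2 ⟨fun a ha => ⟨opX_mem_errorGroup a, ?_⟩,
    fun b hb => ⟨opZ_mem_errorGroup b, ?_⟩⟩
  · exact cssGroup_le_weylSubgroup (opX_mem_cssGroup (h.le ha))
  · exact cssGroup_le_weylSubgroup (opZ_mem_cssGroup hb.1)

/-! Undetectable errors. -/

lemma of_not_detectsQuantum [Fintype κ] [Fintype κ'] {a b : ι → F}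
    (hab : ¬ (h.code eA eB).DetectsQuantum (opX a * opZ b)) :
    (a ∈ M ⊔ R ∧ b ∈ perp (M ⊓ R)) ∧ ¬ (a ∈ R ∧ b ∈ perp M) := by
  constructor
  · by_contra hc
    exact hab (HybridCode.detectsQuantum_of_inner_eq_zero _
      (h.inner_basisState_eq_zero_of_not_commute eA eB hc))
  · rintro ⟨ha, hb⟩
    exact hab (h.actsOnB_of_mem eA eB ⟨0, a, ha, b, hb, fun ψ => by simp⟩).detectsQuantum

lemma of_not_detectsClassical [Fintype κ] {a b : ι → F}
    (hab : ¬ (h.code eA eB).DetectsClassical (opX a * opZ b)) :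
    (a ∈ M ⊔ R ∧ b ∈ perp (M ⊓ R)) ∧ ¬ (a ∈ M ⊔ T ∧ b ∈ perp T) := by
  constructor
  · by_contra hc
    exact hab (HybridCode.detectsClassical_of_inner_eq_zero _ fun _ _ _ _ _ =>
      h.inner_basisState_eq_zero_of_not_commute eA eB hc _ _)
  · rintro ⟨ha, hb⟩
    exact hab (HybridCode.detectsClassical_of_inner_eq_zero _ fun _ _ hkl _ _ =>
      h.inner_basisState_eq_zero_of_commute eA eB ha hb hkl)

/-- Such an X(m) maps φ_0 to a different φ_α within one message, an off-diagonal entry that λ times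
the identity cannot have. -/
lemma not_detectsQuantum_opX [Fintype κ] {m : ι → F} (hm : m ∈ M) (hmR : m ∉ R) :
    ¬ (h.code eA eB).DetectsQuantum (opX m * opZ 0) := by
  intro hd
  obtain ⟨lam, hlam⟩ := hd.inner_eq (eB.symm 0) (eB.symm 0)
  rw [← h.sup_A] at hm
  obtain ⟨α, hα, n, hn, rfl⟩ := Submodule.mem_sup.1 hm
  have hα0 : (⟨α, hα⟩ : A) ≠ 0 := by
    rintro hz
    have hz' : α = 0 := congrArg Subtype.val hz
    exact hmR (by simpa [hz'] using hn.2)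
  have h1 := hlam (eA.symm ⟨α, hα⟩) (eA.symm 0)
  rw [(h.code eA eB).orthonormal.2 (by simp [hα0])] at h1
  have h2 : (opX (α + n) * opZ 0 : QuditUnitary F ι) ((h.code eA eB).state (eA.symm 0, eB.symm 0))
      = (h.code eA eB).state (eA.symm ⟨α, hα⟩, eB.symm 0) := by
    rw [opZ_zero, mul_one, code_state, ← opX_opX, h.opX_basisState_of_mem_inf eA eB hn,
      opX_basisState_of_mem_A eA eB ⟨α, hα⟩]
    simp [code_state]
  rw [h2, mul_zero] at h1
  exact (h.code eA eB).orthonormal.ne_zero _ (inner_self_eq_zero.1 h1)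

/-- Such a Z(b) is diagonal on A with entries that are not all equal. -/
lemma not_detectsQuantum_opZ [Fintype κ] {b : ι → F} (hb : b ∈ perp R) (hbM : b ∉ perp M) :
    ¬ (h.code eA eB).DetectsQuantum (opX 0 * opZ b) := by
  intro hd
  obtain ⟨lam, hlam⟩ := hd.inner_eq (eB.symm 0) (eB.symm 0)
  have h1 : ∀ i, phase (b ⬝ᵥ (eA i : ι → F)) = lam := fun i => by
    have := hlam i i
    rwa [opX_zero, one_mul, code_state, h.opZ_basisState_of_mem_perp_R eA eB hb, inner_smul_right,
      inner_self_eq_norm_sq_to_K, ← h.code_state eA eB, (h.code eA eB).orthonormal.1,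
      RCLike.ofReal_one, one_pow, mul_one, mul_one] at this
  obtain ⟨m, hm, hne⟩ := exists_phase_dotProduct_ne_one hbM
  rw [← h.sup_A] at hm
  obtain ⟨α, hα, n, hn, rfl⟩ := Submodule.mem_sup.1 hm
  have h2 := (h1 (eA.symm ⟨α, hα⟩)).trans (h1 (eA.symm 0)).symm
  simp only [Equiv.apply_symm_apply, Submodule.coe_zero, dotProduct_zero, phase_zero] at h2
  rw [dotProduct_comm, dotProduct_add, mem_perp'.1 hb n hn.2, add_zero] at hne
  exact hne h2

end CSSGaugeFixing
end GaugeFixing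

/-! Distances of the hybrid Bacon–Casaccino code. -/

section Distance

variable {F : Type*} [Field F] {n₁ n₂ : ℕ}
variable {C : Submodule F (Fin n₁ → F)} {D : Submodule F (Fin n₂ → F)}
  {a : Fin n₁ × Fin n₂ → F}

lemma latticeTensor_dotProduct_eq_zero (ha : a ∈ colSpace n₂ C ⊔ rowSpace n₁ D)
    {p : Fin n₁ → F} (hp : p ∈ perp C) {v : Fin n₂ → F} (hv : v ∈ perp D) :
    latticeTensor p v ⬝ᵥ a = 0 := by
  rw [← perp_inf_perp, perp_colSpace, perp_rowSpace] at ha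
  exact mem_perp.1 ha _ ⟨latticeTensor_mem_colSpace hp v, latticeTensor_mem_rowSpace hv p⟩

lemma latticeTensor_single_right_notMem_rowSpace {x : Fin n₁ → F} (hx : x ≠ 0)
    {v : Fin n₂ → F} (hv : v ∈ D) {j : Fin n₂} (hj : v j ≠ 0) :
    latticeTensor x (Pi.single j 1) ∉ rowSpace n₁ (perp D) := fun h => by
  obtain ⟨i, hi⟩ := Function.ne_iff.1 hx
  have := mem_perp.1 (h i) v hv
  simp [latticeTensor, dotProduct, Pi.single_apply, hj] at this
  exact hi this

lemma latticeTensor_single_left_notMem_colSpace {y : Fin n₂ → F} (hy : y ≠ 0)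
    {u : Fin n₁ → F} (hu : u ∈ C) {i : Fin n₁} (hi : u i ≠ 0) :
    latticeTensor (Pi.single i 1) y ∉ colSpace n₂ (perp C) := fun h => by
  obtain ⟨j, hj⟩ := Function.ne_iff.1 hy
  have := mem_perp.1 (h j) u hu
  simp [latticeTensor, dotProduct, Pi.single_apply, hi] at this
  exact hj this

lemma exists_cssGaugeFixing {ι : Type*} [Fintype ι] {M R T : Submodule F (ι → F)}
    (h₁ : M ⊓ R ≤ T) (h₂ : T ≤ R) : ∃ A B D, CSSGaugeFixing M R T A B D := by
  obtain ⟨A, hA, hA'⟩ := exists_disjoint_sup_eq (inf_le_left : M ⊓ R ≤ M)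
  obtain ⟨B, hB, hB'⟩ := exists_disjoint_sup_eq h₂
  obtain ⟨D, hD, hD'⟩ := exists_disjoint_sup_eq (inf_le_left : perp M ⊓ perp T ≤ perp M)
  exact ⟨A, B, D, h₁, h₂, hA, hA', hB, hB', hD, hD'⟩

variable [DecidableEq F]

lemma minDist_le {n : ℕ} {C : Submodule F (Fin n → F)} {x : Fin n → F} (hx : x ∈ C)
    (h0 : x ≠ 0) : minDist C ≤ (hammingNorm x : ℕ∞) := by
  rw [← hammingDist_zero_right]
  exact iInf₂_le_of_le x hx (iInf₂_le_of_le 0 C.zero_mem (iInf_le _ h0))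

lemma exists_hammingNorm_eq {n d : ℕ} {C : Submodule F (Fin n → F)} (h : minDist C = (d : ℕ∞)) :
    ∃ x ∈ C, x ≠ 0 ∧ hammingNorm x = d := by
  by_contra! hc
  have h1 : ∀ x ∈ C, x ≠ 0 → d + 1 ≤ hammingNorm x := fun x hx h0 => by
    have h2 := minDist_le hx h0
    rw [h, Nat.cast_le] at h2
    exact lt_of_le_of_ne h2 (hc x hx h0).symm
  have h3 : ((d + 1 : ℕ) : ℕ∞) ≤ minDist C :=
    le_iInf₂ fun x hx => le_iInf₂ fun y hy => le_iInf fun hxy => by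
      rw [hammingDist_eq_hammingNorm, Nat.cast_le]
      exact h1 _ (C.add_mem (C.neg_mem hx) hy) (mt neg_add_eq_zero.1 hxy)
  rw [h, Nat.cast_le] at h3
  lia

lemma hammingNorm_le_of_fiber {ι κ : Type*} [Fintype ι] [Fintype κ] [DecidableEq κ] (f : ι → κ)
    {a : ι → F} {x : κ → F} (h : ∀ k, x k ≠ 0 → ∃ i, f i = k ∧ a i ≠ 0) :
    hammingNorm x ≤ hammingNorm a := by
  refine (Finset.card_le_card (t := (Finset.univ.filter fun i => a i ≠ 0).image f) ?_).trans
    Finset.card_image_le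
  intro k hk
  obtain ⟨i, rfl, hi⟩ := h k (by simpa using hk)
  exact Finset.mem_image.2 ⟨i, by simpa using hi, rfl⟩

lemma hammingNorm_le_errorWeight_left {ι : Type*} [Fintype ι] (a b : ι → F) :
    hammingNorm a ≤ errorWeight a b :=
  Finset.card_le_card fun i hi => by
    simp only [Finset.mem_filter, Finset.mem_univ, true_and] at hi ⊢
    exact Or.inl hi

lemma hammingNorm_le_errorWeight_right {ι : Type*} [Fintype ι] (a b : ι → F) :
    hammingNorm b ≤ errorWeight a b :=
  Finset.card_le_card fun i hi => by
    simp only [Finset.mem_filter, Finset.mem_univ, true_and] at hi ⊢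
    exact Or.inr hi

lemma errorWeight_zero_right {ι : Type*} [Fintype ι] (a : ι → F) :
    errorWeight a 0 = hammingNorm a := by
  simp [errorWeight, hammingNorm]

lemma errorWeight_zero_left {ι : Type*} [Fintype ι] (b : ι → F) :
    errorWeight 0 b = hammingNorm b := by
  simp [errorWeight, hammingNorm]

lemma hammingNorm_latticeTensor_single_right_le (x : Fin n₁ → F) (j : Fin n₂) :
    hammingNorm (latticeTensor x (Pi.single j 1)) ≤ hammingNorm x := by
  refine (Finset.card_le_card (t := (Finset.univ.filter fun i => x i ≠ 0).image (·, j)) ?_).trans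
    Finset.card_image_le
  rintro ⟨i, j'⟩ hk
  have hk' : x i ≠ 0 ∧ j' = j := by simpa [latticeTensor, Pi.single_apply, and_comm] using hk
  exact Finset.mem_image.2 ⟨i, by simpa using hk'.1, by rw [hk'.2]⟩

lemma hammingNorm_latticeTensor_single_left_le (i : Fin n₁) (y : Fin n₂ → F) :
    hammingNorm (latticeTensor (Pi.single i 1) y) ≤ hammingNorm y := by
  refine (Finset.card_le_card (t := (Finset.univ.filter fun j => y j ≠ 0).image (i, ·)) ?_).trans
    Finset.card_image_le
  rintro ⟨i', j⟩ hk
  have hk' : i' = i ∧ y j ≠ 0 := by simpa [latticeTensor, Pi.single_apply] using hk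
  exact Finset.mem_image.2 ⟨j, by simpa using hk'.2, by rw [hk'.1]⟩

/-- Choose v ∈ D^⊥ not orthogonal to some row of a. Pairing every row with v kills the part in
`rowSpace` and leaves a combination of columns in C; this nonzero word is supported on rows where a
is nonzero. -/
lemma minDist_le_of_notMem_rowSpace (ha : a ∈ colSpace n₂ C ⊔ rowSpace n₁ D)
    (ha' : a ∉ rowSpace n₁ D) : minDist C ≤ (hammingNorm a : ℕ∞) := by
  rw [mem_rowSpace] at ha'
  push Not at ha'
  obtain ⟨i, hi⟩ := ha'
  rw [← perp_perp D, mem_perp'] at hi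
  push Not at hi
  obtain ⟨v, hv, hiv⟩ := hi
  have hmem : (fun i => (fun j => a (i, j)) ⬝ᵥ v) ∈ C := by
    rw [← perp_perp C, mem_perp]
    intro p hp
    rw [← latticeTensor_dotProduct_left]
    exact latticeTensor_dotProduct_eq_zero ha hp hv
  refine (minDist_le hmem fun h => hiv (congrFun h i)).trans (Nat.cast_le.2 ?_)
  refine hammingNorm_le_of_fiber Prod.fst fun i hi => ?_
  obtain ⟨j, -, hj⟩ := Finset.exists_ne_zero_of_sum_ne_zero hi
  exact ⟨(i, j), rfl, left_ne_zero_of_mul hj⟩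

lemma minDist_le_of_notMem_colSpace (ha : a ∈ colSpace n₂ C ⊔ rowSpace n₁ D)
    (ha' : a ∉ colSpace n₂ C) : minDist D ≤ (hammingNorm a : ℕ∞) := by
  rw [mem_colSpace] at ha'
  push Not at ha'
  obtain ⟨j, hj⟩ := ha'
  rw [← perp_perp C, mem_perp'] at hj
  push Not at hj
  obtain ⟨p, hp, hjp⟩ := hj
  have hmem : (fun j => (fun i => a (i, j)) ⬝ᵥ p) ∈ D := by
    rw [← perp_perp D, mem_perp]
    intro v hv
    rw [← latticeTensor_dotProduct_right]
    exact latticeTensor_dotProduct_eq_zero ha hp hv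
  refine (minDist_le hmem fun h => hjp (congrFun h j)).trans (Nat.cast_le.2 ?_)
  refine hammingNorm_le_of_fiber Prod.snd fun j hj => ?_
  obtain ⟨i, -, hi⟩ := Finset.exists_ne_zero_of_sum_ne_zero hj
  exact ⟨(i, j), rfl, left_ne_zero_of_mul hi⟩

variable [Fintype F]

/-- Every group of mutually commuting `X`-type gauge operators between the `X`-type stabilizers and
the `X`-type gauge group, together with the `Z`-type gauge operators that commute with it, gives a
gauge fixing of the Bacon–Casaccino code with quantum distance `min d₁ d₂`. -/
lemma exists_isGaugeFixing_of_intermediate {k₁ k₂ d₁ d₂ : ℕ}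
    (C₁ : Submodule F (Fin n₁ → F)) (C₂ : Submodule F (Fin n₂ → F))
    (h₁ : IsLinearCode C₁ k₁ d₁) (h₂ : IsLinearCode C₂ k₂ d₂)
    {T : Submodule F (Fin n₁ × Fin n₂ → F)}
    (hT : colSpace n₂ C₁ ⊓ rowSpace n₁ (perp C₂) ≤ T) (hT' : T ≤ rowSpace n₁ (perp C₂)) :
    ∃ Q : HybridCode F (Fin n₁ × Fin n₂)
        (Fin (Fintype.card F ^ (k₁ * k₂)))
        (Fin (Fintype.card F ^ ((n₁ - k₁) * (n₂ - k₂)))),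
      Q.IsGaugeFixing (bcStabilizer C₁ C₂) (bcGauge C₁ C₂) ∧
      Q.quantumDistance = (min d₁ d₂ : ℕ) ∧
      ∀ a b, ¬ Q.DetectsClassical (opX a * opZ b) →
        (a ∈ colSpace n₂ C₁ ⊔ rowSpace n₁ (perp C₂) ∧
          b ∈ colSpace n₂ (perp C₁) ⊔ rowSpace n₁ C₂) ∧
        ¬ (a ∈ colSpace n₂ C₁ ⊔ T ∧ b ∈ perp T) := by
  obtain ⟨A, B, D, h⟩ := exists_cssGaugeFixing hT hT'
  have hk₁ : k₁ ≤ n₁ := by simpa [h₁.1] using Submodule.finrank_le C₁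
  have hk₂ : k₂ ≤ n₂ := by simpa [h₂.1] using Submodule.finrank_le C₂
  have hA := h.finrank_A_add
  have hB := h.finrank_B_add_finrank_D_add
  rw [finrank_colSpace_inf_rowSpace, finrank_perp, Fintype.card_fin, h₁.1, h₂.1] at hA hB
  rw [finrank_colSpace, h₁.1] at hA
  rw [finrank_rowSpace, finrank_perp, Fintype.card_fin, h₂.1] at hB
  have hA' : finrank F A = k₁ * k₂ := by
    -- Writing n₂ = k₂ + r₂ removes the truncated subtraction from k₁ n₂ - k₁ (n₂ - k₂).
    obtain ⟨r₂, rfl⟩ := Nat.exists_eq_add_of_le hk₂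
    rw [add_tsub_cancel_left] at hA
    linarith
  have hB' : finrank F B + finrank F D = (n₁ - k₁) * (n₂ - k₂) := by
    rw [tsub_mul]
    lia
  classical
  let eA : Fin (Fintype.card F ^ (k₁ * k₂)) ≃ A := (Fintype.equivFinOfCardEq (by
    rw [Module.card_eq_pow_finrank (K := F), hA'])).symm
  let eB : Fin (Fintype.card F ^ ((n₁ - k₁) * (n₂ - k₂))) ≃ B × D := (Fintype.equivFinOfCardEq (by
    rw [Fintype.card_prod, Module.card_eq_pow_finrank (K := F) (V := B),
      Module.card_eq_pow_finrank (K := F) (V := D), ← pow_add, hB'])).symm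
  have hpM : perp (colSpace n₂ C₁) = colSpace n₂ (perp C₁) := perp_colSpace C₁
  have hpR : perp (rowSpace n₁ (perp C₂)) = rowSpace n₁ C₂ := by
    rw [perp_rowSpace, perp_perp]
  refine ⟨h.code eA eB, ?_, le_antisymm ?_ ?_, fun a b hab => ?_⟩
  · have := h.isGaugeFixing eA eB
    rwa [hpM, hpR, ← bcStabilizer_eq, ← bcGauge_eq] at this
  · obtain ⟨x, hx, hx0, rfl⟩ := exists_hammingNorm_eq h₁.2
    obtain ⟨y, hy, hy0, rfl⟩ := exists_hammingNorm_eq h₂.2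
    rw [(Nat.mono_cast (α := ℕ∞)).map_min]
    refine le_min ?_ ?_
    -- A minimum weight word x of C₁ is placed in one column j; a word of C₂ that is nonzero at j
    -- shows that the pattern is not in R.
    · obtain ⟨j, hj⟩ := Function.ne_iff.1 hy0
      refine (iInf₂_le_of_le (latticeTensor x (Pi.single j 1)) 0 (iInf_le _
        (h.not_detectsQuantum_opX eA eB (latticeTensor_mem_colSpace hx _)
          (latticeTensor_single_right_notMem_rowSpace hx0 hy hj)))).trans ?_
      rw [errorWeight_zero_right, Nat.cast_le]
      exact hammingNorm_latticeTensor_single_right_le x j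
    -- Dually, a minimum weight word y of C₂ is placed in one row i where some word of C₁ is
    -- nonzero.
    · obtain ⟨i, hi⟩ := Function.ne_iff.1 hx0
      refine (iInf₂_le_of_le 0 (latticeTensor (Pi.single i 1) y) (iInf_le _
        (h.not_detectsQuantum_opZ eA eB (hpR ▸ latticeTensor_mem_rowSpace hy _)
          (hpM ▸ latticeTensor_single_left_notMem_colSpace hy0 hx hi)))).trans ?_
      rw [errorWeight_zero_left, Nat.cast_le]
      exact hammingNorm_latticeTensor_single_left_le i y
  · refine le_iInf₂ fun a b => le_iInf fun hab => ?_
    obtain ⟨⟨ha, hb⟩, hab'⟩ := h.of_not_detectsQuantum eA eB hab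
    rw [perp_inf, hpM, hpR] at hb
    rw [hpM, not_and_or] at hab'
    rw [(Nat.mono_cast (α := ℕ∞)).map_min, ← h₁.2, ← h₂.2]
    rcases hab' with ha' | hb'
    · exact (min_le_left _ _).trans ((minDist_le_of_notMem_rowSpace ha ha').trans
        (Nat.cast_le.2 (hammingNorm_le_errorWeight_left a b)))
    · exact (min_le_right _ _).trans ((minDist_le_of_notMem_colSpace hb hb').trans
        (Nat.cast_le.2 (hammingNorm_le_errorWeight_right a b)))
  · have := h.of_not_detectsClassical eA eB hab
    rwa [perp_inf, hpM, hpR] at this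

end Distance

end

theorem mainTheorem2 {F : Type*} [Field F] [Fintype F] [DecidableEq F]
    {n₁ n₂ k₁ k₂ d₁ d₂ : ℕ}
    (C₁ : Submodule F (Fin n₁ → F)) (C₂ : Submodule F (Fin n₂ → F))
    (h₁ : IsLinearCode C₁ k₁ d₁) (h₂ : IsLinearCode C₂ k₂ d₂) :
    ∃ Q : HybridCode F (Fin n₁ × Fin n₂)
        (Fin (Fintype.card F ^ (k₁ * k₂)))
        (Fin (Fintype.card F ^ ((n₁ - k₁) * (n₂ - k₂)))),
      Q.IsGaugeFixing (bcStabilizer C₁ C₂) (bcGauge C₁ C₂) ∧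
      Q.quantumDistance = (min d₁ d₂ : ℕ) ∧
      min ((min d₁ d₂ : ℕ) : ℕ∞) (max (minDist (dualCode C₁)) (minDist (dualCode C₂)))
        ≤ Q.classicalDistance := by
  have hpM : perp (colSpace n₂ C₁) = colSpace n₂ (perp C₁) := perp_colSpace C₁
  have hpR : perp (rowSpace n₁ (perp C₂)) = rowSpace n₁ C₂ := by rw [perp_rowSpace, perp_perp]
  rw [dualCode_eq_perp, dualCode_eq_perp]
  rcases le_total (minDist (perp C₁)) (minDist (perp C₂)) with hle | hle
  -- The smallest choice T = M ∩ R has T^⊥ = M^⊥ + R^⊥ and M + T = M, so only X-type components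
  -- outside M can confuse messages. The bound by the maximum of the dual distances holds without
  -- the minimum with d.
  · obtain ⟨Q, hQ, hd, hc⟩ := exists_isGaugeFixing_of_intermediate C₁ C₂ h₁ h₂ le_rfl inf_le_right
    refine ⟨Q, hQ, hd, (min_le_right _ _).trans ?_⟩
    rw [max_eq_right hle]
    refine le_iInf₂ fun a b => le_iInf fun hab => ?_
    obtain ⟨⟨ha, hb⟩, hab'⟩ := hc a b hab
    rw [perp_inf, hpM, hpR, sup_inf_self] at hab'
    exact (minDist_le_of_notMem_colSpace ha fun ha' => hab' ⟨ha', hb⟩).trans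
      (Nat.cast_le.2 (hammingNorm_le_errorWeight_left a b))
  -- The largest choice T = R has M + T = M + R, so only Z-type components outside R^⊥ can confuse
  -- messages.
  · obtain ⟨Q, hQ, hd, hc⟩ := exists_isGaugeFixing_of_intermediate C₁ C₂ h₁ h₂ inf_le_right le_rfl
    refine ⟨Q, hQ, hd, (min_le_right _ _).trans ?_⟩
    rw [max_eq_left hle]
    refine le_iInf₂ fun a b => le_iInf fun hab => ?_
    obtain ⟨⟨ha, hb⟩, hab'⟩ := hc a b hab
    rw [hpR] at hab'
    exact (minDist_le_of_notMem_rowSpace hb fun hb' => hab' ⟨ha, hb'⟩).trans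
      (Nat.cast_le.2 (hammingNorm_le_errorWeight_right a b))
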